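/- Let $n\ge 0$, let $\Omega\subseteq\mathbb{R}^n$ be open and connected, and let $v\in C^2(\Omega)$ satisfy $|\nabla v(x)|=1$ and $\Delta v(x)=\tilde g(v(x))$ for all $x\in\Omega$, for some function $\tilde g$ (no regularity of $\tilde g$ is assumed). Then $v$ is real-analytic in $\Omega$. Moreover, if $v(x_0)=0$ at some point $x_0\in\Omega$, then there are an open neighbourhood $U\subseteq\Omega$ of $x_0$, an integer $m\ge 0$ and distinct nonzero constants $c_1,\dots,c_m\in\mathbb{R}$ such that, with $c_0:=0$, for every $x\in U$ one has $1+c_iv(x)>0$ for $i=0,\dots,m$, and the Hessian matrix of $v$ is $$\mathcal{H}v(x)=\sum_{i=0}^m\frac{c_i}{1+c_iv(x)}\,P_i(x),$$ where $P_0(x),\dots,P_m(x)$ is a complete set of eigenprojections of $\mathcal{H}v(x)$: the numbers $\kappa_i(x)=c_i/(1+c_iv(x))$, $i=0,\dots,m$, are pairwise distinct and are exactly the eigenvalues of $\mathcal{H}v(x)$, each $P_i(x)$ is the symmetric projection matrix whose range is the eigenspace of $\kappa_i(x)$, $P_i(x)P_j(x)=0$ for $i\ne j$, and $\sum_{i=0}^mP_i(x)=I$.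 In particular, the eigenvalues of $\mathcal{H}v$ in $U$, counted with multiplicity, depend only on the value of $v$: if $x,y\in U$ and $v(x)=v(y)$, then $\mathcal{H}v(x)$ and $\mathcal{H}v(y)$ have the same characteristic polynomial. -/

import Mathlib

open scoped Gradient

/-- The Hessian matrix of `v` at `x`: its `(i, j)` entry is the second partial derivative
`∂²v / ∂xᵢ∂xⱼ` at `x`, i.e. the second derivative of `v` applied to the standard basis vectors
`eᵢ`, `eⱼ`. -/
noncomputable def hessianMatrix {n : ℕ} (v : EuclideanSpace ℝ (Fin n) → ℝ)
    (x : EuclideanSpace ℝ (Fin n)) : Matrix (Fin n) (Fin n) ℝ :=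
  Matrix.of fun i j =>
    iteratedFDeriv ℝ 2 v x ![EuclideanSpace.single i 1, EuclideanSpace.single j 1]

/-- `P` is the eigenprojection of `X` for the eigenvalue `κ`: `κ` is an eigenvalue of `X`, and `P`
is the symmetric projection matrix whose range is the (whole) eigenspace of `κ`. -/
structure IsEigenprojection {n : ℕ} (X : Matrix (Fin n) (Fin n) ℝ) (κ : ℝ)
    (P : Matrix (Fin n) (Fin n) ℝ) : Prop where
  hasEigenvalue : Module.End.HasEigenvalue (Matrix.toLin' X) κ
  isSymm : P.IsSymm
  idem : P * P = P
  range_eq : LinearMap.range (Matrix.toLin' P) = Module.End.eigenspace (Matrix.toLin' X) κ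

/-- `P` is a complete set of eigenprojections of `X`, with unrepeated eigenvalues `κ`: the `κ i`
are pairwise distinct, they are all the eigenvalues of `X`, each `P i` is the eigenprojection for
`κ i`, the `P i` are mutually orthogonal and sum up to the identity. -/
structure IsCompleteSetOfEigenprojections {n : ℕ} {ι : Type} [Fintype ι]
    (X : Matrix (Fin n) (Fin n) ℝ) (κ : ι → ℝ) (P : ι → Matrix (Fin n) (Fin n) ℝ) : Prop where
  injective : Function.Injective κ
  isEigenprojection : ∀ i, IsEigenprojection X (κ i) (P i)
  exhaustive : ∀ μ : ℝ, Module.End.HasEigenvalue (Matrix.toLin' X) μ → ∃ i, κ i = μ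
  orthogonal : ∀ i j, i ≠ j → P i * P j = 0
  sum_eq_one : ∑ i, P i = 1

/-!
Write `N = ∇v` and `H` for the Hessian, the derivative of `N`. Differentiating `‖N‖² = 1` gives
`H N = 0`, and Grönwall's inequality then shows that `N` is constant along the line `x + t N(x)`
(`EikonalOnBall.gradient_add_smul_gradient`), on which `v` grows at unit speed. Differentiating
`N(x + t N(x)) = N(x)` in `x` gives the Riccati relation `H(x + t N(x)) (1 + t H(x)) = H(x)`
(`EikonalOnBall.hessianMatrix_mul`), which needs no more than `v ∈ C²`.

Its trace reads `∑ λ i / (1 + t * λ i) = g (v x + t)`, where `λ i` are the eigenvalues of `H(x)`.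
The left side is the logarithmic derivative of `∏ (1 + t * λ i)`, so the value `v x` determines the
characteristic polynomial of `H(x)` (`EikonalOnBall.charpoly_eq`). Near a zero `x₀` of `v`, each
point `x` is `y + v(x) N(y)` with `v y = 0`; then `H(y)` has the eigenvalues `c i` of `H(x₀)`, and
the Riccati relation with `t = v x` exhibits `H(x)` as the function `c ↦ c / (1 + c * v x)` of
`H(y)`, with the eigenprojections of `H(y)` (`EikonalOnBall.exists_eigenprojections`).

The same trace formula, with `v` shifted so that `v x₀ = 0`, shows that near `0` the function `g` is
`p' / p` with `p(s) = ∏ (1 + s * λ i)` for the eigenvalues `λ i` of `H(x₀)`. A primitive `φ` of `1 / p` satisfies `φ'' + g φ' = 0`, hence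
`Δ (φ ∘ v) = φ'' ‖N‖² + φ' g(v) = 0`. Harmonic functions are analytic (`analyticAt_of_harmonicAt`),
and `v` is recovered from `φ ∘ v` by the analytic inverse function theorem. The analyticity of
harmonic functions comes from the mean value property for a smooth kernel, which passes to
derivatives and yields Cauchy estimates.
-/

open MeasureTheory Filter Topology Set Metric
open scoped ContDiff RealInnerProductSpace Convolution

/-! ### The mean value property of harmonic functions -/

section MeanValue

theorem hasCompactSupport_of_eq_zero {E F : Type*} [NormedAddCommGroup E] [ProperSpace E]
    [Zero F] {f : E → F} {r : ℝ}
    (h : ∀ z, r ≤ ‖z‖ → f z = 0) : HasCompactSupport f := by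
  refine HasCompactSupport.intro (isCompact_closedBall (0 : E) r) fun z hz => h z ?_
  simp only [mem_closedBall, dist_zero_right, not_le] at hz
  exact hz.le

variable {E : Type*} [NormedAddCommGroup E] [InnerProductSpace ℝ E] [FiniteDimensional ℝ E]
  [MeasurableSpace E] [BorelSpace E]

/-- `ρ` is a smooth kernel of total mass one, supported in the closed unit ball, such that the vector
field `z ↦ ρ z • z` is the gradient of some `C¹` function `ψ` supported in the closed unit ball.
Radial bump functions have this property, and it is the only consequence of radial symmetry that the
mean value property needs. -/
structure IsMeanValueKernel (μ : Measure E) (ρ : E → ℝ) : Prop where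
  contDiff : ContDiff ℝ ∞ ρ
  eq_zero : ∀ z, 1 ≤ ‖z‖ → ρ z = 0
  integral_eq_one : ∫ z, ρ z ∂μ = 1
  exists_potential : ∃ ψ : E → ℝ, ContDiff ℝ 1 ψ ∧ (∀ z, 1 ≤ ‖z‖ → ψ z = 0) ∧
    ∀ z w, fderiv ℝ ψ z w = ρ z * ⟪z, w⟫

/-- A multiple of the radial bump `β (‖z‖²)`, `β t = expNegInvGlue (1 - t)`, is a mean value kernel;
its potential is `η (‖z‖²)`, where `η` is the primitive of `β / 2` that vanishes for `t ≥ 1`. -/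
theorem exists_isMeanValueKernel (μ : Measure E) [μ.IsAddHaarMeasure] :
    ∃ ρ : E → ℝ, IsMeanValueKernel μ ρ := by
  set β : ℝ → ℝ := fun t => expNegInvGlue (1 - t) with hβ
  have hβs : ContDiff ℝ ∞ β := expNegInvGlue.contDiff.comp (contDiff_const.sub contDiff_id)
  set ρ₀ : E → ℝ := fun z => β (‖z‖ ^ 2) with hρ₀
  have hρs : ContDiff ℝ ∞ ρ₀ := hβs.comp (contDiff_id.norm_sq ℝ)
  have hρz : ∀ z, 1 ≤ ‖z‖ → ρ₀ z = 0 := fun z hz => by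
    simp only [hρ₀, hβ]
    apply expNegInvGlue.zero_of_nonpos
    nlinarith
  have hpos : 0 < ∫ z, ρ₀ z ∂μ := by
    refine hρs.continuous.integral_pos_of_hasCompactSupport_nonneg_nonzero
      (hasCompactSupport_of_eq_zero hρz) (fun z => expNegInvGlue.nonneg _) (x := 0) ?_
    simp [hρ₀, hβ]
  set c := (∫ z, ρ₀ z ∂μ)⁻¹ with hc
  -- Integrating from `1` makes the primitive vanish on `[1, ∞)`, where `β = 0`.
  have hβ' : ∀ t, HasDerivAt (fun t => ∫ s in (1 : ℝ)..t, c * β s / 2) (c * β t / 2) t := fun t => by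
    have hcont : Continuous fun s => c * β s / 2 := by
      have := hβs.continuous
      fun_prop
    exact (hcont.integral_hasStrictDerivAt 1 t).hasDerivAt
  set η : ℝ → ℝ := fun t => ∫ s in (1 : ℝ)..t, c * β s / 2 with hη
  refine ⟨fun z => c * ρ₀ z, contDiff_const.mul hρs, fun z hz => by simp [hρz z hz], ?_,
    fun z => η (‖z‖ ^ 2), ?_, ?_, ?_⟩
  · rw [integral_const_mul, hc, inv_mul_cancel₀ hpos.ne']
  · have h1 : ContDiff ℝ 1 η := by
      rw [contDiff_one_iff_deriv]
      refine ⟨fun t => (hβ' t).differentiableAt, ?_⟩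
      have : deriv η = fun t => c * β t / 2 := funext fun t => (hβ' t).deriv
      rw [this]
      have := hβs.continuous
      fun_prop
    exact h1.comp (contDiff_id.norm_sq ℝ)
  · intro z hz
    simp only [hη]
    have h1 : (1 : ℝ) ≤ ‖z‖ ^ 2 := by nlinarith
    rw [intervalIntegral.integral_congr (g := fun _ => 0), intervalIntegral.integral_zero]
    intro s hs
    rw [uIcc_of_le h1] at hs
    simp only [hβ]
    rw [expNegInvGlue.zero_of_nonpos (by linarith [hs.1])]
    simp
  · intro z w
    have h1 := (hβ' (‖z‖ ^ 2)).hasFDerivAt.comp z (hasStrictFDerivAt_norm_sq z).hasFDerivAt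
    have h2 : fderiv ℝ (fun z => η (‖z‖ ^ 2)) z = _ := h1.fderiv
    rw [h2]
    simp [hρ₀, innerSL_apply_apply]
    ring

variable {μ : Measure E} {ρ : E → ℝ}

namespace IsMeanValueKernel

omit [BorelSpace E] in
theorem hasCompactSupport (hρ : IsMeanValueKernel μ ρ) : HasCompactSupport ρ :=
  hasCompactSupport_of_eq_zero hρ.eq_zero

variable [μ.IsAddHaarMeasure]

/-- Integration by parts against the potential `ψ` of `ρ` turns the integral into
`s * ∫ ψ z * Δ u (x - s • z)`, and the Laplacian vanishes on the support of `ψ`. -/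
theorem integral_mul_fderiv_eq_zero (hρ : IsMeanValueKernel μ ρ) {u : E → ℝ}
    (hu : ContDiff ℝ 2 u) {x : E} {s : ℝ}
    (hΔ : ∀ z, ‖z‖ < 1 → Laplacian.laplacian u (x - s • z) = 0) :
    ∫ z, ρ z * fderiv ℝ u (x - s • z) z ∂μ = 0 := by
  obtain ⟨ψ, hψ, hψ0, hψρ⟩ := hρ.exists_potential
  have hψc : HasCompactSupport ψ := hasCompactSupport_of_eq_zero hψ0
  let b := stdOrthonormalBasis ℝ E
  have hDu : ContDiff ℝ 1 (fderiv ℝ u) := hu.fderiv_right (by norm_num)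
  let g : Fin (Module.finrank ℝ E) → E → ℝ := fun i z => fderiv ℝ u (x - s • z) (b i)
  have hg : ∀ i, ContDiff ℝ 1 (g i) := fun i =>
    (hDu.comp (contDiff_const.sub (contDiff_const.smul contDiff_id))).clm_apply contDiff_const
  have hψ'cont : ∀ i, Continuous fun z => fderiv ℝ ψ z (b i) := fun i =>
    (hψ.continuous_fderiv one_ne_zero).clm_apply continuous_const
  have hg'cont : ∀ i, Continuous fun z => fderiv ℝ (g i) z (b i) := fun i =>
    ((hg i).continuous_fderiv one_ne_zero).clm_apply continuous_const
  have hψ'c : ∀ i, HasCompactSupport fun z => fderiv ℝ ψ z (b i) := fun i =>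
    (hψc.fderiv ℝ).comp_left (g := fun L : E →L[ℝ] ℝ => L (b i)) (by simp)
  have hint1 : ∀ i, Integrable (fun z => fderiv ℝ ψ z (b i) * g i z) μ := fun i =>
    ((hψ'cont i).mul (hg i).continuous).integrable_of_hasCompactSupport ((hψ'c i).mul_right)
  have hint2 : ∀ i, Integrable (fun z => ψ z * fderiv ℝ (g i) z (b i)) μ := fun i =>
    (hψ.continuous.mul (hg'cont i)).integrable_of_hasCompactSupport hψc.mul_right
  have hint3 : ∀ i, Integrable (fun z => ψ z * g i z) μ := fun i =>
    (hψ.continuous.mul (hg i).continuous).integrable_of_hasCompactSupport hψc.mul_right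
  have hparts : ∀ i, ∫ z, fderiv ℝ ψ z (b i) * g i z ∂μ
      = - ∫ z, ψ z * fderiv ℝ (g i) z (b i) ∂μ := fun i => by
    rw [integral_mul_fderiv_eq_neg_fderiv_mul_of_integrable (hint1 i) (hint2 i) (hint3 i)
      (fun z _ => hψ.differentiable one_ne_zero z)
      (fun z _ => (hg i).differentiable one_ne_zero z), neg_neg]
  have hexp : ∀ z, ρ z * fderiv ℝ u (x - s • z) z = ∑ i, fderiv ℝ ψ z (b i) * g i z := fun z => by
    have h1 : ∀ L : E →L[ℝ] ℝ, L z = ∑ i, ⟪z, b i⟫ * L (b i) := fun L => by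
      conv_lhs => rw [← b.sum_repr' z]
      simp [real_inner_comm]
    rw [h1, Finset.mul_sum]
    simp only [hψρ, g, mul_assoc]
  have hg' : ∀ i z, fderiv ℝ (g i) z (b i) =
      -s * iteratedFDeriv ℝ 2 u (x - s • z) ![b i, b i] := fun i z => by
    have h1 : HasFDerivAt (fun z => x - s • z) (-(s • ContinuousLinearMap.id ℝ E)) z := by
      simpa using ((hasFDerivAt_id z).const_smul s).const_sub x
    have h2 := ((hDu.differentiable one_ne_zero (x - s • z)).hasFDerivAt.comp z h1).clm_apply
      (hasFDerivAt_const (b i) z)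
    have h3 : fderiv ℝ (g i) z = _ := h2.fderiv
    rw [h3, iteratedFDeriv_two_apply]
    simp
  simp_rw [hexp]
  rw [integral_finsetSum _ fun i _ => hint1 i]
  simp_rw [hparts]
  rw [Finset.sum_neg_distrib, ← integral_finsetSum _ fun i _ => hint2 i, neg_eq_zero]
  refine integral_eq_zero_of_ae (Eventually.of_forall fun z => ?_)
  simp only [hg', Pi.zero_apply]
  rcases lt_or_ge ‖z‖ 1 with hz | hz
  · have h4 : ∑ i, iteratedFDeriv ℝ 2 u (x - s • z) ![b i, b i] = 0 :=
      (congrFun (InnerProductSpace.laplacian_eq_iteratedFDeriv_orthonormalBasis u b)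
        (x - s • z)).symm.trans (hΔ z hz)
    rw [← Finset.mul_sum, ← Finset.mul_sum, h4]
    simp
  · simp [hψ0 z hz]

end IsMeanValueKernel

variable [μ.IsAddHaarMeasure]

/-- Every value `f x` is the `ρ`-average of `f` over the ball of radius `s` about `x`, whenever this
closed ball lies in the open ball of radius `R` about `x₀`. The kernel is rescaled by sampling `f`
at `x - s • z`. -/
def HasMeanValueProperty {F : Type*} [NormedAddCommGroup F] [NormedSpace ℝ F] (μ : Measure E)
    (ρ : E → ℝ) (f : E → F) (x₀ : E) (R : ℝ) : Prop :=
  ∀ x s, 0 < s → ‖x - x₀‖ + s < R → ∫ z, ρ z • f (x - s • z) ∂μ = f x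

/-- The `ρ`-average of `u` over the ball of radius `t` about `x` has zero derivative in `t`, and at
`t = 0` it is `u x`. -/
theorem IsMeanValueKernel.hasMeanValueProperty_of_laplacian_eq_zero (hρ : IsMeanValueKernel μ ρ)
    {u : E → ℝ} (hu : ContDiff ℝ 2 u) (huc : HasCompactSupport u) {x₀ : E} {R : ℝ}
    (hΔ : ∀ y ∈ ball x₀ R, Laplacian.laplacian u y = 0) :
    HasMeanValueProperty μ ρ u x₀ R := by
  intro x s hs hsR
  have hDu : Continuous (fderiv ℝ u) := hu.continuous_fderiv two_ne_zero
  obtain ⟨C, hC⟩ : ∃ C, ∀ y, ‖fderiv ℝ u y‖ ≤ C :=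
    (huc.fderiv ℝ).exists_bound_of_continuous hDu
  have hderiv : ∀ t : ℝ, HasDerivAt (fun t => ∫ z, ρ z * u (x - t • z) ∂μ)
      (∫ z, ρ z * -(fderiv ℝ u (x - t • z) z) ∂μ) t := fun t => by
    refine (hasDerivAt_integral_of_dominated_loc_of_deriv_le (s := univ)
      (F := fun (t : ℝ) z => ρ z * u (x - t • z))
      (F' := fun (t : ℝ) z => ρ z * -(fderiv ℝ u (x - t • z) z))
      (bound := fun z => ‖ρ z‖ * (C * ‖z‖)) univ_mem ?_ ?_ ?_ ?_ ?_ ?_).2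
    · refine Eventually.of_forall fun t => Continuous.aestronglyMeasurable ?_
      exact hρ.contDiff.continuous.mul (hu.continuous.comp (by fun_prop))
    · refine Continuous.integrable_of_hasCompactSupport ?_ hρ.hasCompactSupport.mul_right
      exact hρ.contDiff.continuous.mul (hu.continuous.comp (by fun_prop))
    · refine Continuous.aestronglyMeasurable ?_
      exact hρ.contDiff.continuous.mul
        ((hDu.comp (by fun_prop : Continuous fun z => x - t • z)).clm_apply continuous_id).neg
    · refine Eventually.of_forall fun z t _ => ?_
      rw [norm_mul, norm_neg]
      gcongr
      exact ((fderiv ℝ u (x - t • z)).le_opNorm z).trans (by gcongr; exact hC _)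
    · refine Continuous.integrable_of_hasCompactSupport ?_ hρ.hasCompactSupport.norm.mul_right
      exact hρ.contDiff.continuous.norm.mul (by fun_prop)
    · refine Eventually.of_forall fun z t _ => ?_
      have h1 : HasDerivAt (fun t : ℝ => x - t • z) (-z) t := by
        simpa using ((hasDerivAt_id t).smul_const z).const_sub x
      have h2 := ((hu.differentiable two_ne_zero (x - t • z)).hasFDerivAt.comp_hasDerivAt t
        h1).const_mul (ρ z)
      simpa using! h2
  have hconst : (∫ z, ρ z * u (x - s • z) ∂μ) = ∫ z, ρ z * u (x - (0 : ℝ) • z) ∂μ := by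
    refine constant_of_has_deriv_right_zero (a := 0) (b := s)
      (fun t _ => (hderiv t).continuousAt.continuousWithinAt) ?_ s ⟨hs.le, le_rfl⟩
    intro t ht
    have h0 := hρ.integral_mul_fderiv_eq_zero (x := x) (s := t) hu fun z hz => hΔ _ (by
      rw [mem_ball, dist_eq_norm]
      calc ‖x - t • z - x₀‖ = ‖(x - x₀) - t • z‖ := by congr 1; abel
        _ ≤ ‖x - x₀‖ + ‖t • z‖ := norm_sub_le _ _
        _ ≤ ‖x - x₀‖ + s := by
          rw [norm_smul, Real.norm_of_nonneg ht.1]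
          have := mul_le_mul ht.2.le hz.le (norm_nonneg z) hs.le
          linarith
        _ < R := hsR)
    have h1 := hderiv t
    simp only [mul_neg, integral_neg, h0, neg_zero] at h1
    exact h1.hasDerivWithinAt
  simp only [smul_eq_mul]
  rw [hconst]
  simp [integral_mul_const, hρ.integral_eq_one]

end MeanValue

/-! ### Interior derivative estimates -/

section InteriorEstimates

variable {E : Type*} [NormedAddCommGroup E] [InnerProductSpace ℝ E] [FiniteDimensional ℝ E]

/-- The kernel `ρ` concentrated on the ball of radius `s`, with its total mass kept. -/
noncomputable def rescale (ρ : E → ℝ) (s : ℝ) (z : E) : ℝ :=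
  (s ^ Module.finrank ℝ E)⁻¹ * ρ (s⁻¹ • z)

variable [MeasurableSpace E] [BorelSpace E] {μ : Measure E} [μ.IsAddHaarMeasure] {ρ : E → ℝ}
  {F : Type*} [NormedAddCommGroup F] [NormedSpace ℝ F]

open ContinuousLinearMap (lsmul)

namespace IsMeanValueKernel

omit [FiniteDimensional ℝ E] [BorelSpace E] [μ.IsAddHaarMeasure] in
theorem contDiff_rescale (hρ : IsMeanValueKernel μ ρ) (s : ℝ) : ContDiff ℝ ∞ (rescale ρ s) :=
  contDiff_const.mul (hρ.contDiff.comp (contDiff_const.smul contDiff_id))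

omit [FiniteDimensional ℝ E] [BorelSpace E] [μ.IsAddHaarMeasure] in
theorem rescale_eq_zero (hρ : IsMeanValueKernel μ ρ) {s : ℝ} (hs : 0 < s) (z : E) (hz : s ≤ ‖z‖) :
    rescale ρ s z = 0 := by
  rw [rescale, hρ.eq_zero, mul_zero]
  rw [norm_smul, norm_inv, Real.norm_of_nonneg hs.le, inv_mul_eq_div, le_div_iff₀ hs, one_mul]
  exact hz

omit [BorelSpace E] [μ.IsAddHaarMeasure] in
theorem hasCompactSupport_rescale (hρ : IsMeanValueKernel μ ρ) {s : ℝ} (hs : 0 < s) :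
    HasCompactSupport (rescale ρ s) :=
  hasCompactSupport_of_eq_zero (hρ.rescale_eq_zero hs)

theorem convolution_rescale_apply {s : ℝ} (hs : 0 < s) (f : E → F) (x : E) :
    (rescale ρ s ⋆[lsmul ℝ ℝ, μ] f) x = ∫ z, ρ z • f (x - s • z) ∂μ := by
  have h := Measure.integral_comp_smul μ (fun t => rescale ρ s t • f (x - t)) s
  have hd : 0 < s ^ Module.finrank ℝ E := pow_pos hs _
  rw [abs_of_pos (inv_pos.2 hd), eq_inv_smul_iff₀ hd.ne', ← integral_smul] at h
  rw [convolution_def]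
  simp only [ContinuousLinearMap.lsmul_apply]
  rw [← h]
  refine integral_congr_ae (Eventually.of_forall fun z => ?_)
  simp only [rescale, inv_smul_smul₀ hs.ne', smul_smul]
  rw [mul_inv_cancel_left₀ hd.ne']

theorem integral_norm_fderiv_rescale (hρ : IsMeanValueKernel μ ρ) {s : ℝ} (hs : 0 < s) :
    ∫ z, ‖fderiv ℝ (rescale ρ s) z‖ ∂μ = s⁻¹ * ∫ z, ‖fderiv ℝ ρ z‖ ∂μ := by
  have hd : 0 < s ^ Module.finrank ℝ E := pow_pos hs _
  have h1 : ∀ z, fderiv ℝ (rescale ρ s) z =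
      ((s ^ Module.finrank ℝ E)⁻¹ * s⁻¹) • fderiv ℝ ρ (s⁻¹ • z) := fun z => by
    have : rescale ρ s = fun z => (s ^ Module.finrank ℝ E)⁻¹ • ρ (s⁻¹ • z) := rfl
    rw [this, fderiv_fun_const_smul (f := fun z => ρ (s⁻¹ • z)) ((hρ.contDiff.differentiable (by simp)).comp
      (differentiable_id.const_smul s⁻¹) z), fderiv_comp_smul, smul_smul]
  simp_rw [h1, norm_smul, integral_const_mul]
  rw [Measure.integral_comp_smul μ (fun z => ‖fderiv ℝ ρ z‖) s⁻¹, inv_pow, inv_inv,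
    abs_of_pos hd, Real.norm_of_nonneg (by positivity), smul_eq_mul]
  field_simp

theorem eventuallyEq_convolution {f : E → F} {x₀ : E} {R : ℝ}
    (hf : HasMeanValueProperty μ ρ f x₀ R) {x : E} {s : ℝ} (hs : 0 < s) (hx : ‖x - x₀‖ + s < R) :
    f =ᶠ[𝓝 x] rescale ρ s ⋆[lsmul ℝ ℝ, μ] f := by
  have : ∀ᶠ y in 𝓝 x, ‖y - x₀‖ + s < R :=
    (by fun_prop : Continuous fun y => ‖y - x₀‖ + s).continuousAt.eventually_lt
      continuousAt_const hx
  filter_upwards [this] with y hy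
  rw [convolution_rescale_apply hs, hf y s hs hy]

/-- Differentiating `f = rescale ρ s ⋆ f` with the derivative falling on `f`. -/
theorem hasMeanValueProperty_fderiv (hρ : IsMeanValueKernel μ ρ) [CompleteSpace F] {f : E → F}
    (hf : ContDiff ℝ 1 f) (hfc : HasCompactSupport f) {x₀ : E} {R : ℝ}
    (hm : HasMeanValueProperty μ ρ f x₀ R) :
    HasMeanValueProperty μ ρ (fderiv ℝ f) x₀ R := by
  intro x s hs hx
  have h1 := (eventuallyEq_convolution hm hs hx).fderiv_eq (𝕜 := ℝ)
  have hloc : LocallyIntegrable (rescale ρ s) μ :=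
    (hρ.contDiff_rescale s).continuous.locallyIntegrable
  rw [(hfc.hasFDerivAt_convolution_right (lsmul ℝ ℝ) hloc hf x).fderiv] at h1
  have hint : Integrable (fun z => ρ z • fderiv ℝ f (x - s • z)) μ := by
    refine Continuous.integrable_of_hasCompactSupport ?_ hρ.hasCompactSupport.smul_right
    exact hρ.contDiff.continuous.smul ((hf.continuous_fderiv one_ne_zero).comp (by fun_prop))
  ext w
  rw [h1, convolution_precompR_apply _ hloc (hfc.fderiv ℝ) (hf.continuous_fderiv one_ne_zero),
    convolution_rescale_apply hs, ContinuousLinearMap.integral_apply hint w]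
  rfl

/-- Differentiating `f = rescale ρ s ⋆ f` with the derivative falling on the kernel. -/
theorem norm_fderiv_le (hρ : IsMeanValueKernel μ ρ) {f : E → F}
    (hf : Continuous f) {x₀ : E} {R M : ℝ}
    (hm : HasMeanValueProperty μ ρ f x₀ R) (hM : ∀ y ∈ ball x₀ R, ‖f y‖ ≤ M) {x : E} {s : ℝ}
    (hs : 0 < s) (hx : ‖x - x₀‖ + s < R) :
    ‖fderiv ℝ f x‖ ≤ s⁻¹ * (∫ z, ‖fderiv ℝ ρ z‖ ∂μ) * M := by
  rw [(eventuallyEq_convolution hm hs hx).fderiv_eq (𝕜 := ℝ),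
    ((hρ.hasCompactSupport_rescale hs).hasFDerivAt_convolution_left (lsmul ℝ ℝ)
      ((hρ.contDiff_rescale s).of_le (by simp)) hf.locallyIntegrable x).fderiv,
    convolution_def, ← hρ.integral_norm_fderiv_rescale hs, ← integral_mul_const]
  have hcont : Continuous (fderiv ℝ (rescale ρ s)) :=
    (hρ.contDiff_rescale s).continuous_fderiv (by simp)
  refine norm_integral_le_of_norm_le ?_ (Eventually.of_forall fun t => ?_)
  · exact (hcont.norm.integrable_of_hasCompactSupport
      ((hρ.hasCompactSupport_rescale hs).fderiv ℝ).norm).mul_const _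
  · by_cases ht : t ∈ tsupport (rescale ρ s)
    · have ht' : ‖t‖ ≤ s := by
        have hsub : tsupport (rescale ρ s) ⊆ closedBall 0 s := by
          refine closure_minimal (fun z hz => ?_) isClosed_closedBall
          rw [mem_closedBall, dist_zero_right]
          by_contra h
          exact hz (hρ.rescale_eq_zero hs z (not_le.1 h).le)
        simpa using hsub ht
      have hb : ‖f (x - t)‖ ≤ M := hM _ (by
        rw [mem_ball, dist_eq_norm]
        calc ‖x - t - x₀‖ = ‖(x - x₀) - t‖ := by congr 1; abel
          _ ≤ ‖x - x₀‖ + ‖t‖ := norm_sub_le _ _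
          _ < R := by linarith)
      refine ContinuousLinearMap.opNorm_le_bound _ (by
        have := (norm_nonneg _).trans hb
        positivity) fun w => ?_
      have : ((lsmul ℝ ℝ).precompL E (fderiv ℝ (rescale ρ s) t) (f (x - t))) w
          = fderiv ℝ (rescale ρ s) t w • f (x - t) := rfl
      rw [this, norm_smul]
      calc _ ≤ (‖fderiv ℝ (rescale ρ s) t‖ * ‖w‖) * M := by
            gcongr
            exact (fderiv ℝ (rescale ρ s) t).le_opNorm w
        _ = _ := by ring
    · have : fderiv ℝ (rescale ρ s) t = 0 := by
        by_contra h
        exact ht (support_fderiv_subset ℝ h)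
      simp [this]

end IsMeanValueKernel
end InteriorEstimates

section Cauchy

open IsMeanValueKernel

variable {E : Type} [NormedAddCommGroup E] [InnerProductSpace ℝ E] [FiniteDimensional ℝ E]
  [MeasurableSpace E] [BorelSpace E] {μ : Measure E} [μ.IsAddHaarMeasure] {ρ : E → ℝ}

/-- Cauchy estimates. To pass from `k` to `k + 1`, apply the estimate for `k` to the derivative of `f`
on the ball whose radius is `k / (k + 1)` of the given one; the shell that remains bounds that
derivative. -/
theorem IsMeanValueKernel.norm_iteratedFDeriv_le (hρ : IsMeanValueKernel μ ρ) (k : ℕ) :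
    ∀ {F : Type} [NormedAddCommGroup F] [NormedSpace ℝ F] [CompleteSpace F] {f : E → F}
    (_ : ContDiff ℝ ∞ f) (_ : HasCompactSupport f) {x₀ : E} {R M : ℝ} (_ : 0 < R)
    (_ : HasMeanValueProperty μ ρ f x₀ R) (_ : ∀ y ∈ ball x₀ R, ‖f y‖ ≤ M),
    ‖iteratedFDeriv ℝ k f x₀‖ ≤ (k * (2 * ∫ z, ‖fderiv ℝ ρ z‖ ∂μ) / R) ^ k * M := by
  set C := ∫ z, ‖fderiv ℝ ρ z‖ ∂μ with hC
  have hC0 : 0 ≤ C := integral_nonneg fun z => norm_nonneg _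
  induction k with
  | zero =>
    intro F _ _ _ f _ _ x₀ R M hR _ hM
    simpa using hM x₀ (mem_ball_self hR)
  | succ k ih =>
    intro F _ _ _ f hf hfc x₀ R M hR hm hM
    have hM0 : 0 ≤ M := (norm_nonneg _).trans (hM x₀ (mem_ball_self hR))
    rw [← norm_iteratedFDeriv_fderiv]
    have hk : (0 : ℝ) < k + 1 := by positivity
    have hD : ∀ y ∈ ball x₀ (k * R / (k + 1)), ‖fderiv ℝ f y‖ ≤ (R / (2 * (k + 1)))⁻¹ * C * M := by
      intro y hy
      rw [mem_ball, dist_eq_norm] at hy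
      refine hρ.norm_fderiv_le hf.continuous hm hM (by positivity) ?_
      have : k * R / (k + 1) + R / (2 * (k + 1)) < R := by
        rw [div_add_div _ _ (by positivity) (by positivity), div_lt_iff₀ (by positivity)]
        nlinarith [mul_pos hR hk]
      linarith
    -- For `k = 0` the smaller ball is empty, so the first derivative is bounded directly.
    rcases Nat.eq_zero_or_pos k with rfl | hk0
    · have := hρ.norm_fderiv_le hf.continuous hm hM (x := x₀) (s := R / 2) (by positivity)
        (by simpa using hR)
      rw [norm_iteratedFDeriv_zero]
      refine this.trans (le_of_eq ?_)
      simp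
      left
      ring
    · have hk1 : (0 : ℝ) < k := by exact_mod_cast hk0
      have hR' : 0 < k * R / (k + 1) := by positivity
      have hm' : HasMeanValueProperty μ ρ (fderiv ℝ f) x₀ (k * R / (k + 1)) := fun x s hs hx =>
        hρ.hasMeanValueProperty_fderiv (hf.of_le (by simp)) hfc hm x s hs (hx.trans (by
          rw [div_lt_iff₀ hk]; nlinarith))
      refine (ih (hf.fderiv_right (m := ∞) (by simp)) (hfc.fderiv ℝ) hR' hm' hD).trans
        (le_of_eq ?_)
      have h1 : k * (2 * C) / (k * R / (k + 1)) = (k + 1) * (2 * C) / R := by field_simp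
      have h2 : (R / (2 * (k + 1)))⁻¹ * C * M = (k + 1) * (2 * C) / R * M := by field_simp
      rw [h1, h2, pow_succ, mul_assoc]
      push_cast
      rfl

end Cauchy

/-! ### Analyticity of harmonic functions -/

section Analyticity

open scoped Nat

theorem iteratedDeriv_comp_add_smul {E F : Type*} [NormedAddCommGroup E] [NormedSpace ℝ E]
    [NormedAddCommGroup F] [NormedSpace ℝ F] {f : E → F} (hf : ContDiff ℝ ∞ f) (x y : E) (k : ℕ)
    (t : ℝ) :
    iteratedDeriv k (fun t : ℝ => f (x + t • y)) t =
      iteratedFDeriv ℝ k f (x + t • y) fun _ => y := by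
  have h1 : (fun t : ℝ => f (x + t • y)) =
      (fun z => f (x + z)) ∘ ContinuousLinearMap.toSpanSingleton ℝ y := by
    ext t; simp
  rw [iteratedDeriv_eq_iteratedFDeriv, h1, ContinuousLinearMap.iteratedFDeriv_comp_right (n := ∞)
    (f := fun z => f (x + z)) _ (hf.comp (contDiff_const.add contDiff_id)) _
    (by exact_mod_cast le_top),
    iteratedFDeriv_comp_add_left]
  simp

/-- A smooth function with `‖D^k f‖ ≤ (k A)^k M` on a ball is the sum of its Taylor series, as
`k ^ k / k! ≤ e ^ k`; the remainder is estimated along segments. -/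
theorem analyticAt_of_norm_iteratedFDeriv_le {E F : Type*} [NormedAddCommGroup E]
    [NormedSpace ℝ E] [NormedAddCommGroup F] [NormedSpace ℝ F] [CompleteSpace F] {f : E → F}
    (hf : ContDiff ℝ ∞ f) {x : E} {r A M : ℝ} (hr : 0 < r) (hA : 0 ≤ A)
    (h : ∀ (k : ℕ), ∀ y ∈ ball x r, ‖iteratedFDeriv ℝ k f y‖ ≤ (k * A) ^ k * M) :
    AnalyticAt ℝ f x := by
  have hM : 0 ≤ M := by
    simpa using (norm_nonneg _).trans (h 0 x (mem_ball_self hr))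
  set B := Real.exp 1 * A with hB
  have hB0 : 0 ≤ B := by positivity
  have hfac : ∀ k : ℕ, ((k ! : ℕ) : ℝ)⁻¹ * (k * A) ^ k ≤ B ^ k := fun k => by
    have := Real.pow_div_factorial_le_exp (k : ℝ) (Nat.cast_nonneg k) k
    rw [← Real.exp_one_pow] at this
    rw [mul_pow, mul_pow, ← mul_assoc]
    gcongr
    rwa [inv_mul_eq_div]
  let p : FormalMultilinearSeries ℝ E F := fun k => ((k ! : ℕ) : ℝ)⁻¹ • iteratedFDeriv ℝ k f x
  have hp : ∀ k, ‖p k‖ ≤ B ^ k * M := fun k => by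
    simp only [p, norm_smul, norm_inv, RCLike.norm_natCast]
    calc _ ≤ ((k ! : ℕ) : ℝ)⁻¹ * ((k * A) ^ k * M) := by
          gcongr
          exact h k x (mem_ball_self hr)
      _ ≤ B ^ k * M := by
          rw [← mul_assoc]
          gcongr
          exact hfac k
  set δ : ℝ := min r (1 / (2 * (B + 1))) with hδ
  have hδ0 : 0 < δ := by positivity
  have hBδ : ∀ t, t ≤ δ → B * t ≤ 1 / 2 := fun t ht => by
    have h1 : t ≤ 1 / (2 * (B + 1)) := ht.trans (min_le_right _ _)
    calc B * t ≤ B * (1 / (2 * (B + 1))) := by gcongr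
      _ ≤ 1 / 2 := by
        rw [mul_one_div, div_le_div_iff₀ (by positivity) (by positivity)]
        linarith
  refine ⟨p, ENNReal.ofReal δ, ?_, ENNReal.ofReal_pos.2 hδ0, ?_⟩
  · refine p.le_radius_of_bound M (r := δ.toNNReal) fun k => ?_
    rw [Real.coe_toNNReal _ hδ0.le]
    calc ‖p k‖ * δ ^ k ≤ B ^ k * M * δ ^ k := by gcongr; exact hp k
      _ = (B * δ) ^ k * M := by rw [mul_pow]; ring
      _ ≤ 1 * M := by
        gcongr
        exact pow_le_one₀ (by positivity) ((hBδ δ le_rfl).trans (by norm_num))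
      _ = M := one_mul M
  · intro y hy
    rw [Metric.eball_ofReal, mem_ball, dist_zero_right] at hy
    set q := B * ‖y‖ with hq
    have hq0 : 0 ≤ q := by positivity
    have hq1 : q < 1 := (hBδ _ hy.le).trans_lt (by norm_num)
    have hterm : ∀ k, ‖p k fun _ => y‖ ≤ q ^ k * M := fun k => by
      refine ((p k).le_opNorm _).trans ?_
      rw [Finset.prod_const, Finset.card_univ, Fintype.card_fin, hq, mul_pow]
      calc ‖p k‖ * ‖y‖ ^ k ≤ B ^ k * M * ‖y‖ ^ k := by gcongr; exact hp k
        _ = _ := by ring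
    have hsum : Summable fun k => p k fun _ => y :=
      Summable.of_norm_bounded ((summable_geometric_of_lt_one hq0 hq1).mul_right M) hterm
    rw [hsum.hasSum_iff_tendsto_nat, ← tendsto_add_atTop_iff_nat 1]
    have hg : ContDiff ℝ ∞ fun t : ℝ => f (x + t • y) :=
      hf.comp (contDiff_const.add (contDiff_id.smul contDiff_const))
    have hwithin : ∀ (k : ℕ), ∀ t ∈ Icc (0 : ℝ) 1,
        iteratedDerivWithin k (fun t : ℝ => f (x + t • y)) (Icc 0 1) t =
          iteratedFDeriv ℝ k f (x + t • y) fun _ => y := fun k t ht => by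
      rw [iteratedDerivWithin_eq_iteratedDeriv (uniqueDiffOn_Icc one_pos)
        (hg.contDiffAt.of_le (by exact_mod_cast le_top)) ht, iteratedDeriv_comp_add_smul hf]
    have herr : ∀ n : ℕ, ‖(∑ k ∈ Finset.range (n + 1), p k fun _ => y) - f (x + y)‖ ≤
        ((n + 1 : ℕ) : ℝ) * q ^ (n + 1) * M := fun n => by
      have h1 := taylor_mean_remainder_bound (f := fun t : ℝ => f (x + t • y)) (n := n)
        (C := ((n + 1 : ℕ) * A) ^ (n + 1) * M * ‖y‖ ^ (n + 1)) zero_le_one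
        (hg.contDiffOn.of_le (by exact_mod_cast le_top)) (right_mem_Icc.2 zero_le_one)
        (fun t ht => by
          rw [hwithin _ t ht]
          refine ((iteratedFDeriv ℝ (n + 1) f (x + t • y)).le_opNorm _).trans ?_
          rw [Finset.prod_const, Finset.card_univ, Fintype.card_fin]
          gcongr
          refine h (n + 1) _ ?_
          rw [mem_ball, dist_eq_norm, add_sub_cancel_left, norm_smul, Real.norm_of_nonneg ht.1]
          have : t * ‖y‖ ≤ 1 * ‖y‖ := by gcongr; exact ht.2
          linarith [hy.trans_le (min_le_left _ _)])
      rw [taylor_within_apply, norm_sub_rev] at h1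
      simp only [sub_zero, one_pow, mul_one, one_smul] at h1
      have h2 : ∑ k ∈ Finset.range (n + 1), (p k fun _ => y) =
          ∑ k ∈ Finset.range (n + 1), ((k ! : ℕ) : ℝ)⁻¹ •
            iteratedDerivWithin k (fun t : ℝ => f (x + t • y)) (Icc 0 1) 0 :=
        Finset.sum_congr rfl fun k _ => by
          rw [hwithin k 0 (left_mem_Icc.2 zero_le_one)]
          simp [p]
      rw [h2]
      refine h1.trans ?_
      have h3 : ((n ! : ℕ) : ℝ)⁻¹ = (n + 1 : ℕ) * (((n + 1) ! : ℕ) : ℝ)⁻¹ := by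
        rw [Nat.factorial_succ]
        push_cast
        field_simp
      rw [div_eq_inv_mul, h3, hq, mul_pow]
      calc _ = ((n + 1 : ℕ) : ℝ) * ((((n + 1) ! : ℕ) : ℝ)⁻¹ * ((n + 1 : ℕ) * A) ^ (n + 1)) *
            (M * ‖y‖ ^ (n + 1)) := by ring
        _ ≤ ((n + 1 : ℕ) : ℝ) * B ^ (n + 1) * (M * ‖y‖ ^ (n + 1)) := by
          gcongr
          exact hfac (n + 1)
        _ = _ := by ring
    rw [tendsto_iff_norm_sub_tendsto_zero]
    refine squeeze_zero (fun n => norm_nonneg _) herr ?_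
    have := ((tendsto_add_atTop_iff_nat 1).2
      (tendsto_self_mul_const_pow_of_lt_one hq0 hq1)).mul_const M
    simpa using this

/-- A cutoff of `u` is a global `C²` function, harmonic on a smaller ball; its convolution with the
kernel is smooth and still agrees with `u` near `x`, and the Cauchy estimates apply to it. -/
theorem analyticAt_of_harmonicAt {E : Type} [NormedAddCommGroup E] [InnerProductSpace ℝ E]
    [FiniteDimensional ℝ E] {u : E → ℝ} {x : E}
    (hu : InnerProductSpace.HarmonicAt u x) : AnalyticAt ℝ u x := by
  borelize E
  obtain ⟨ρ, hρ⟩ := exists_isMeanValueKernel (volume : Measure E)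
  obtain ⟨ε, hε, hball⟩ := Metric.eventually_nhds_iff_ball.1 hu.eventually
  set R := ε / 3 with hR
  have hR0 : 0 < R := by positivity
  let χ : ContDiffBump x := ⟨R, 2 * R, hR0, by linarith⟩
  set v : E → ℝ := fun y => χ y * u y with hv
  have hvc : HasCompactSupport v := χ.hasCompactSupport.mul_right
  have hvs : ContDiff ℝ 2 v := contDiff_iff_contDiffAt.2 fun y => by
    by_cases hy : y ∈ tsupport v
    swap
    · exact contDiffAt_const.congr_of_eventuallyEq (notMem_tsupport_iff_eventuallyEq.1 hy)
    have hy' : y ∈ ball x ε := by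
      have := (tsupport_mul_subset_left : tsupport v ⊆ _) hy
      rw [χ.tsupport_eq] at this
      refine closedBall_subset_ball ?_ this
      change 2 * R < ε
      linarith
    exact χ.contDiffAt.mul (hball y hy').1
  have hvu : ∀ y ∈ ball x R, v =ᶠ[𝓝 y] u := fun y hy => by
    filter_upwards [isOpen_ball.mem_nhds hy] with z hz
    simp only [hv]
    rw [χ.one_of_mem_closedBall (ball_subset_closedBall hz), one_mul]
  have hvΔ : ∀ y ∈ ball x R, Laplacian.laplacian v y = 0 := fun y hy => by
    rw [(InnerProductSpace.laplacian_congr_nhds (hvu y hy)).eq_of_nhds]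
    exact (hball y (ball_subset_ball (by linarith) hy)).2.eq_of_nhds
  have hvm := hρ.hasMeanValueProperty_of_laplacian_eq_zero hvs hvc hvΔ
  have hs : 0 < R / 4 := by positivity
  -- The smooth function `f` agrees with `u` near `x`, and is harmonic there.
  set f : E → ℝ := rescale ρ (R / 4) ⋆[ContinuousLinearMap.lsmul ℝ ℝ, volume] v with hf
  have hfs : ContDiff ℝ ∞ f := (hρ.hasCompactSupport_rescale hs).contDiff_convolution_left _
    (hρ.contDiff_rescale _) hvs.continuous.locallyIntegrable
  have hfc : HasCompactSupport f := (hρ.hasCompactSupport_rescale hs).convolution _ hvc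
  have hfv : ∀ y ∈ ball x (R / 2), v =ᶠ[𝓝 y] f := fun y hy =>
    IsMeanValueKernel.eventuallyEq_convolution hvm hs (by
      rw [mem_ball, dist_eq_norm] at hy
      linarith)
  have hfm := hρ.hasMeanValueProperty_of_laplacian_eq_zero (x₀ := x) (R := R / 2)
    (contDiff_infty.1 hfs 2) hfc fun y hy => by
      rw [← (InnerProductSpace.laplacian_congr_nhds (hfv y hy)).eq_of_nhds]
      exact hvΔ y (ball_subset_ball (by linarith) hy)
  obtain ⟨M, hM⟩ := hfc.exists_bound_of_continuous hfs.continuous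
  have hfa : AnalyticAt ℝ f x := by
    refine analyticAt_of_norm_iteratedFDeriv_le hfs hs
      (A := (2 * ∫ z, ‖fderiv ℝ ρ z‖) / (R / 4)) (M := M)
      (div_nonneg (mul_nonneg zero_le_two (integral_nonneg fun z => norm_nonneg _)) hs.le)
      fun k y hy => ?_
    rw [← mul_div_assoc]
    refine hρ.norm_iteratedFDeriv_le k hfs hfc hs (fun z s hs' hz => hfm z s hs' ?_)
      fun z _ => hM z
    rw [mem_ball, dist_eq_norm] at hy
    have : ‖z - x‖ ≤ ‖z - y‖ + ‖y - x‖ := norm_sub_le_norm_sub_add_norm_sub _ _ _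
    linarith
  refine hfa.congr ?_
  exact ((hfv x (mem_ball_self (by positivity))).symm.trans (hvu x (mem_ball_self hR0)))

end Analyticity

/-! ### Eigenprojections of symmetric matrices -/

section Spectral

open Matrix

variable {n : ℕ}

/-- A resolution of the identity by nonzero symmetric matrices `P i` with pairwise vanishing products
is a complete set of eigenprojections of every `∑ i, κ i • P i` with distinct `κ i`. -/
theorem isCompleteSetOfEigenprojections_of_sum_smul {ι : Type} [Fintype ι]
    {X : Matrix (Fin n) (Fin n) ℝ} {κ : ι → ℝ} {P : ι → Matrix (Fin n) (Fin n) ℝ}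
    (hκ : Function.Injective κ) (hsymm : ∀ i, (P i).IsSymm)
    (horth : ∀ i j, i ≠ j → P i * P j = 0) (hsum : ∑ i, P i = 1) (hne : ∀ i, P i ≠ 0)
    (hX : X = ∑ i, κ i • P i) : IsCompleteSetOfEigenprojections X κ P := by
  classical
  have hmul : ∀ (a : ι → ℝ) (i), P i * ∑ j, a j • P j = a i • (P i * P i) := fun a i => by
    rw [Finset.mul_sum, Finset.sum_eq_single i]
    · rw [mul_smul_comm]
    · intro j _ hj
      rw [mul_smul_comm, horth i j hj.symm, smul_zero]
    · simp
  have hidem : ∀ i, P i * P i = P i := fun i => by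
    have := hmul (fun _ => 1) i
    simpa [hsum] using this.symm
  have hPX : ∀ i, P i * X = κ i • P i := fun i => by rw [hX, hmul, hidem]
  have hXP : ∀ i, X * P i = κ i • P i := fun i => by
    rw [hX, Finset.sum_mul, Finset.sum_eq_single i]
    · rw [smul_mul_assoc, hidem]
    · intro j _ hj
      rw [smul_mul_assoc, horth j i hj, smul_zero]
    · simp
  have hdecomp : ∀ w, w = ∑ i, P i *ᵥ w := fun w => by
    rw [← sum_mulVec, hsum, one_mulVec]
  -- On an eigenvector for `μ`, every `P i` with `κ i ≠ μ` vanishes.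
  have hkill : ∀ {μ : ℝ} {w : Fin n → ℝ}, X *ᵥ w = μ • w → ∀ i, κ i ≠ μ → P i *ᵥ w = 0 := by
    intro μ w hw i hi
    have h1 : P i *ᵥ (X *ᵥ w) = κ i • (P i *ᵥ w) := by
      rw [mulVec_mulVec, hPX, smul_mulVec]
    rw [hw, mulVec_smul] at h1
    have h2 : (κ i - μ) • (P i *ᵥ w) = 0 := by rw [sub_smul, h1, sub_self]
    exact (smul_eq_zero.1 h2).resolve_left (sub_ne_zero.2 hi)
  have hrange : ∀ i, LinearMap.range (toLin' (P i)) =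
      Module.End.eigenspace (toLin' X) (κ i) := fun i => by
    ext w
    rw [Module.End.mem_eigenspace_iff, toLin'_apply]
    constructor
    · rintro ⟨z, rfl⟩
      rw [toLin'_apply, mulVec_mulVec, hXP, smul_mulVec]
    · intro hw
      refine ⟨w, ?_⟩
      rw [toLin'_apply]
      conv_rhs => rw [hdecomp w]
      refine (Finset.sum_eq_single i (fun j _ hj => hkill hw j (hκ.ne hj)) (by simp)).symm
  refine ⟨hκ, fun i => ⟨?_, hsymm i, hidem i, hrange i⟩, ?_, horth, hsum⟩
  · rw [Module.End.hasEigenvalue_iff, ← hrange i, Ne, LinearMap.range_eq_bot]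
    simpa using hne i
  · intro μ hμ
    obtain ⟨w, hw, hw0⟩ := hμ.exists_hasEigenvector
    rw [Module.End.mem_eigenspace_iff, toLin'_apply] at hw
    by_contra! h
    exact hw0 (by rw [hdecomp w, Finset.sum_eq_zero fun i _ => hkill hw i (h i)])

namespace Matrix.IsHermitian

variable {A : Matrix (Fin n) (Fin n) ℝ}

/-- The matrix that is diagonal with entries `f` in the orthonormal eigenbasis of `A`. Functions of
`A` have this form, with `f` a function of `hA.eigenvalues`. -/
noncomputable def conjDiagonal (hA : A.IsHermitian) (f : Fin n → ℝ) : Matrix (Fin n) (Fin n) ℝ :=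
  Unitary.conjStarAlgAut ℝ (Matrix (Fin n) (Fin n) ℝ) hA.eigenvectorUnitary (diagonal f)

theorem conjDiagonal_eigenvalues (hA : A.IsHermitian) : hA.conjDiagonal hA.eigenvalues = A := by
  conv_rhs => rw [hA.spectral_theorem]
  rfl

theorem conjDiagonal_mul (hA : A.IsHermitian) (f g : Fin n → ℝ) :
    hA.conjDiagonal f * hA.conjDiagonal g = hA.conjDiagonal (f * g) := by
  rw [conjDiagonal, conjDiagonal, ← map_mul, diagonal_mul_diagonal]
  rfl

theorem conjDiagonal_one (hA : A.IsHermitian) : hA.conjDiagonal 1 = 1 := by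
  rw [conjDiagonal, diagonal_one', map_one]

theorem conjDiagonal_add (hA : A.IsHermitian) (f g : Fin n → ℝ) :
    hA.conjDiagonal (f + g) = hA.conjDiagonal f + hA.conjDiagonal g := by
  rw [conjDiagonal, conjDiagonal, conjDiagonal, ← map_add, diagonal_add]
  rfl

theorem conjDiagonal_smul (hA : A.IsHermitian) (a : ℝ) (f : Fin n → ℝ) :
    hA.conjDiagonal (a • f) = a • hA.conjDiagonal f := by
  rw [conjDiagonal, conjDiagonal, diagonal_smul, map_smul]

theorem conjDiagonal_zero (hA : A.IsHermitian) : hA.conjDiagonal 0 = 0 := by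
  simpa using hA.conjDiagonal_smul 0 0

theorem conjDiagonal_sum {ι : Type*} (s : Finset ι) (hA : A.IsHermitian) (f : ι → Fin n → ℝ) :
    hA.conjDiagonal (∑ i ∈ s, f i) = ∑ i ∈ s, hA.conjDiagonal (f i) := by
  classical
  induction s using Finset.induction_on with
  | empty => exact hA.conjDiagonal_zero
  | insert a s ha ih => rw [Finset.sum_insert ha, Finset.sum_insert ha, conjDiagonal_add, ih]

theorem conjDiagonal_isSymm (hA : A.IsHermitian) (f : Fin n → ℝ) :
    (hA.conjDiagonal f).IsSymm := by
  have h : star (hA.conjDiagonal f) = hA.conjDiagonal f := by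
    rw [conjDiagonal, ← map_star]
    congr 1
    simp [star_eq_conjTranspose]
  rw [star_eq_conjTranspose] at h
  rwa [conjTranspose_eq_transpose_of_trivial] at h

theorem conjDiagonal_injective (hA : A.IsHermitian) : Function.Injective hA.conjDiagonal :=
  (Unitary.conjStarAlgAut ℝ (Matrix (Fin n) (Fin n) ℝ) hA.eigenvectorUnitary).injective.comp
    diagonal_injective

theorem trace_conjDiagonal (hA : A.IsHermitian) (f : Fin n → ℝ) :
    (hA.conjDiagonal f).trace = ∑ i, f i := by
  rw [conjDiagonal, Unitary.conjStarAlgAut_apply, trace_mul_cycle]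
  simp

/-- The solution `Z = A (1 + t A)⁻¹` of the Riccati relation is a function of `A`. -/
theorem eq_conjDiagonal_of_mul_eq (hA : A.IsHermitian) {t : ℝ}
    (ht : ∀ i, 1 + t * hA.eigenvalues i ≠ 0) {Z : Matrix (Fin n) (Fin n) ℝ}
    (hZ : Z * (1 + t • A) = A) :
    Z = hA.conjDiagonal fun i => hA.eigenvalues i / (1 + t * hA.eigenvalues i) := by
  have h1 : 1 + t • A = hA.conjDiagonal fun i => 1 + t * hA.eigenvalues i := by
    conv_lhs => rw [← hA.conjDiagonal_eigenvalues, ← hA.conjDiagonal_one, ← conjDiagonal_smul,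
      ← conjDiagonal_add]
    rfl
  have h2 : (1 + t • A) * hA.conjDiagonal (fun i => (1 + t * hA.eigenvalues i)⁻¹) = 1 := by
    rw [h1, conjDiagonal_mul, ← hA.conjDiagonal_one]
    congr 1
    ext i
    simp [ht i]
  calc Z = Z * (1 + t • A) * hA.conjDiagonal (fun i => (1 + t * hA.eigenvalues i)⁻¹) := by
        rw [mul_assoc, h2, mul_one]
    _ = hA.conjDiagonal hA.eigenvalues *
          hA.conjDiagonal (fun i => (1 + t * hA.eigenvalues i)⁻¹) := by
        rw [hZ, hA.conjDiagonal_eigenvalues]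
    _ = _ := by
        rw [conjDiagonal_mul]
        rfl

theorem trace_eq_sum_of_mul_eq (hA : A.IsHermitian) {t : ℝ}
    (ht : ∀ i, 1 + t * hA.eigenvalues i ≠ 0) {Z : Matrix (Fin n) (Fin n) ℝ}
    (hZ : Z * (1 + t • A) = A) :
    Z.trace = ∑ i, hA.eigenvalues i / (1 + t * hA.eigenvalues i) := by
  rw [hA.eq_conjDiagonal_of_mul_eq ht hZ, trace_conjDiagonal]

theorem exists_isCompleteSetOfEigenprojections (hA : A.IsHermitian) {m : ℕ} {c : Fin m → ℝ}
    (hc : Function.Injective c) (hrange : range c = range hA.eigenvalues) {t : ℝ}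
    (ht : ∀ i, 0 < 1 + c i * t) {Z : Matrix (Fin n) (Fin n) ℝ} (hZ : Z * (1 + t • A) = A) :
    ∃ P : Fin m → Matrix (Fin n) (Fin n) ℝ, Z = ∑ i, (c i / (1 + c i * t)) • P i ∧
      IsCompleteSetOfEigenprojections Z (fun i => c i / (1 + c i * t)) P := by
  classical
  have hpos : ∀ j, 0 < 1 + t * hA.eigenvalues j := fun j => by
    obtain ⟨i, hi⟩ : hA.eigenvalues j ∈ range c := hrange ▸ mem_range_self j
    rw [← hi, mul_comm]
    exact ht i
  have hZ' := hA.eq_conjDiagonal_of_mul_eq (fun j => (hpos j).ne') hZ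
  set P : Fin m → Matrix (Fin n) (Fin n) ℝ := fun i =>
    hA.conjDiagonal fun j => if hA.eigenvalues j = c i then 1 else 0 with hP
  have hsum : ∀ f : ℝ → ℝ, ∑ i, f (c i) • P i = hA.conjDiagonal fun j => f (hA.eigenvalues j) := by
    intro f
    simp only [hP, ← conjDiagonal_smul, ← conjDiagonal_sum]
    congr 1
    ext j
    obtain ⟨i, hi⟩ : hA.eigenvalues j ∈ range c := hrange ▸ mem_range_self j
    simp only [Finset.sum_apply, Pi.smul_apply, smul_eq_mul, mul_ite, mul_one, mul_zero, ← hi,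
      hc.eq_iff]
    simp
  have hZs : Z = ∑ i, (c i / (1 + c i * t)) • P i := by
    rw [hZ', hsum fun x => x / (1 + x * t)]
    simp only [mul_comm t]
  refine ⟨P, hZs, isCompleteSetOfEigenprojections_of_sum_smul ?_
    (fun i => hA.conjDiagonal_isSymm _) ?_ ?_ ?_ hZs⟩
  · intro i j hij
    simp only at hij
    rw [div_eq_div_iff (ht i).ne' (ht j).ne'] at hij
    exact hc (by linarith)
  · intro i j hij
    simp only [hP, conjDiagonal_mul]
    rw [← hA.conjDiagonal_zero]
    congr 1
    ext k
    simp only [Pi.mul_apply, Pi.zero_apply, mul_ite, mul_one, mul_zero]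
    rw [ite_eq_right_iff]
    intro hj
    rw [if_neg fun hi => hij (hc (hi.symm.trans hj))]
  · have := hsum fun _ => 1
    simp only [one_smul] at this
    rw [this, ← hA.conjDiagonal_one]
    rfl
  · intro i h0
    obtain ⟨j, hj⟩ : c i ∈ range hA.eigenvalues := hrange ▸ mem_range_self i
    have h2 := congrFun (hA.conjDiagonal_injective (h0.trans hA.conjDiagonal_zero.symm)) j
    simp [hj] at h2

/-- The sums are the logarithmic derivatives of `∏ i, (1 + t * λ i)`, which is `1` at `t = 0`. So
these products agree for small `t`, and with `t = -s⁻¹` they give the characteristic polynomials at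
all large `s`. -/
theorem charpoly_eq_of_sum_eq (hA : A.IsHermitian) {B : Matrix (Fin n) (Fin n) ℝ}
    (hB : B.IsHermitian) {δ : ℝ} (hδ : 0 < δ)
    (hApos : ∀ t, |t| < δ → ∀ i, 0 < 1 + t * hA.eigenvalues i)
    (hBpos : ∀ t, |t| < δ → ∀ i, 0 < 1 + t * hB.eigenvalues i)
    (hsum : ∀ t, |t| < δ → ∑ i, hA.eigenvalues i / (1 + t * hA.eigenvalues i) =
      ∑ i, hB.eigenvalues i / (1 + t * hB.eigenvalues i)) : A.charpoly = B.charpoly := by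
  have hderiv : ∀ (l : Fin n → ℝ) (t : ℝ), (∀ i, 0 < 1 + t * l i) →
      HasDerivAt (fun t => ∑ i, Real.log (1 + t * l i)) (∑ i, l i / (1 + t * l i)) t := by
    intro l t h
    refine HasDerivAt.fun_sum fun i _ => ?_
    have := (((hasDerivAt_id t).mul_const (l i)).const_add 1).log (h i).ne'
    simpa using this
  have hlog : EqOn (fun t => ∑ i, Real.log (1 + t * hA.eigenvalues i))
      (fun t => ∑ i, Real.log (1 + t * hB.eigenvalues i)) (ball 0 δ) := by
    have hb : ∀ {t : ℝ}, t ∈ ball (0 : ℝ) δ → |t| < δ := fun {t} ht => by simpa using ht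
    refine isOpen_ball.eqOn_of_deriv_eq (convex_ball (0 : ℝ) δ).isPreconnected
      (fun t ht => (hderiv _ t (hApos t (hb ht))).differentiableAt.differentiableWithinAt)
      (fun t ht => (hderiv _ t (hBpos t (hb ht))).differentiableAt.differentiableWithinAt)
      (fun t ht => ?_) (mem_ball_self hδ) (by simp)
    rw [(hderiv _ t (hApos t (hb ht))).deriv, (hderiv _ t (hBpos t (hb ht))).deriv,
      hsum t (hb ht)]
  have hprod : ∀ t, |t| < δ →
      ∏ i, (1 + t * hA.eigenvalues i) = ∏ i, (1 + t * hB.eigenvalues i) := fun t ht => by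
    have h1 := hlog (show t ∈ ball (0 : ℝ) δ by simpa using ht)
    simp only at h1
    rw [← Real.log_prod fun i _ => (hApos t ht i).ne',
      ← Real.log_prod fun i _ => (hBpos t ht i).ne'] at h1
    exact Real.log_injOn_pos (Finset.prod_pos fun i _ => hApos t ht i)
      (Finset.prod_pos fun i _ => hBpos t ht i) h1
  refine Polynomial.eq_of_infinite_eval_eq _ _ ((Ioi_infinite δ⁻¹).mono fun s hs => ?_)
  have hs0 : 0 < s := (inv_pos.2 hδ).trans hs
  have heval : ∀ l : Fin n → ℝ, (∏ i, (Polynomial.X - Polynomial.C (l i))).eval s =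
      s ^ n * ∏ i, (1 + -s⁻¹ * l i) := fun l => by
    rw [Polynomial.eval_prod]
    have : s ^ n = ∏ _i : Fin n, s := by simp
    rw [this, ← Finset.prod_mul_distrib]
    refine Finset.prod_congr rfl fun i _ => ?_
    simp
    field_simp
    ring
  have ht : |-s⁻¹| < δ := by
    rw [abs_neg, abs_of_pos (inv_pos.2 hs0)]
    exact inv_lt_of_inv_lt₀ hδ hs
  simp only [mem_ofPred_eq]
  rw [hA.charpoly_eq, hB.charpoly_eq]
  simp only [RCLike.ofReal_real_eq_id, id_eq]
  rw [heval, heval, hprod _ ht]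

theorem range_eigenvalues (hA : A.IsHermitian) :
    range hA.eigenvalues = {s | A.charpoly.IsRoot s} := by
  ext s
  rw [hA.charpoly_eq, mem_ofPred_eq, Polynomial.IsRoot, Polynomial.eval_prod,
    Finset.prod_eq_zero_iff]
  simp only [mem_range, RCLike.ofReal_real_eq_id, id_eq, Finset.mem_univ, true_and,
    Polynomial.eval_sub, Polynomial.eval_X, Polynomial.eval_C, sub_eq_zero]
  simp only [eq_comm]

end Matrix.IsHermitian

/-- A finite set of reals that contains `0` can be enumerated without repetition starting from `0`. -/
theorem exists_enumeration_zero {S : Finset ℝ} (h0 : (0 : ℝ) ∈ S) :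
    ∃ (m : ℕ) (c : Fin (m + 1) → ℝ), c 0 = 0 ∧ Function.Injective c ∧ range c = S := by
  classical
  let e := (S.erase 0).equivFin.symm
  refine ⟨_, Fin.cons 0 fun i => (e i : ℝ), rfl, ?_, ?_⟩
  · rw [Fin.cons_injective_iff]
    refine ⟨?_, Subtype.val_injective.comp e.injective⟩
    rintro ⟨i, hi⟩
    exact Finset.ne_of_mem_erase (e i).2 hi
  · rw [Fin.range_cons]
    have : range (fun i => (e i : ℝ)) = (S.erase 0 : Finset ℝ) := by
      rw [show (fun i => (e i : ℝ)) = Subtype.val ∘ e from rfl, range_comp, e.surjective.range_eq]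
      exact Subtype.coe_image_univ _
    rw [this, ← Finset.coe_insert, Finset.insert_erase h0]

end Spectral

/-! ### The eikonal equation along gradient lines -/

section Eikonal

variable {E : Type*} [NormedAddCommGroup E] [InnerProductSpace ℝ E] [CompleteSpace E]

theorem contDiffAt_gradient {v : E → ℝ} {x : E} (hv : ContDiffAt ℝ 2 v x) :
    ContDiffAt ℝ 1 (∇ v) x :=
  (InnerProductSpace.toDual ℝ E).symm.toContinuousLinearEquiv.contDiff.contDiffAt.comp x
    (hv.fderiv_right (m := 1) (by norm_num))

theorem inner_fderiv_gradient {v : E → ℝ} {x : E} (hv : ContDiffAt ℝ 2 v x) (a b : E) :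
    ⟪fderiv ℝ (∇ v) x a, b⟫ = fderiv ℝ (fderiv ℝ v) x a b := by
  have h1 : HasFDerivAt (∇ v) _ x :=
    (InnerProductSpace.toDual ℝ E).symm.toContinuousLinearEquiv.hasFDerivAt.comp x
      ((hv.fderiv_right (m := 1) (by norm_num)).differentiableAt one_ne_zero).hasFDerivAt
  rw [h1.fderiv]
  exact InnerProductSpace.toDual_symm_apply

theorem inner_fderiv_gradient_comm {v : E → ℝ} {x : E} (hv : ContDiffAt ℝ 2 v x) (a b : E) :
    ⟪fderiv ℝ (∇ v) x a, b⟫ = ⟪fderiv ℝ (∇ v) x b, a⟫ := by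
  rw [inner_fderiv_gradient hv, inner_fderiv_gradient hv]
  exact hv.isSymmSndFDerivAt (by simp) a b

theorem inner_gradient_eq_fderiv (v : E → ℝ) (x a : E) : ⟪∇ v x, a⟫ = fderiv ℝ v x a :=
  InnerProductSpace.toDual_symm_apply

/-- `v` is a `C²` solution of the eikonal equation `‖∇ v‖ = 1` with Hessian bounded by `K` on the ball
of radius `2 * r` about `x₀`. The factor `2` leaves room for following gradient lines that start in
the ball of radius `r` for any time less than `r`. -/
structure EikonalOnBall (v : E → ℝ) (x₀ : E) (r K : ℝ) : Prop where
  contDiffAt : ∀ x ∈ ball x₀ (2 * r), ContDiffAt ℝ 2 v x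
  norm_gradient : ∀ x ∈ ball x₀ (2 * r), ‖∇ v x‖ = 1
  norm_fderiv_gradient_le : ∀ x ∈ ball x₀ (2 * r), ‖fderiv ℝ (∇ v) x‖ ≤ K

namespace EikonalOnBall

variable {v : E → ℝ} {x₀ : E} {r K : ℝ}

theorem hasFDerivAt_gradient (h : EikonalOnBall v x₀ r K) {x : E} (hx : x ∈ ball x₀ (2 * r)) :
    HasFDerivAt (∇ v) (fderiv ℝ (∇ v) x) x :=
  ((contDiffAt_gradient (h.contDiffAt x hx)).differentiableAt one_ne_zero).hasFDerivAt

/-- Differentiate `‖∇ v‖² = 1` and use the symmetry of the Hessian. -/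
theorem fderiv_gradient_gradient (h : EikonalOnBall v x₀ r K) {x : E}
    (hx : x ∈ ball x₀ (2 * r)) : fderiv ℝ (∇ v) x (∇ v x) = 0 := by
  refine ext_inner_right ℝ fun a => ?_
  rw [inner_fderiv_gradient_comm (h.contDiffAt x hx), inner_zero_left]
  have h1 : HasFDerivAt (fun y => ⟪∇ v y, ∇ v y⟫) _ x :=
    (h.hasFDerivAt_gradient hx).inner ℝ (h.hasFDerivAt_gradient hx)
  have h2 : (fun y => ⟪∇ v y, ∇ v y⟫) =ᶠ[𝓝 x] fun _ => (1 : ℝ) := by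
    filter_upwards [isOpen_ball.mem_nhds hx] with y hy
    rw [real_inner_self_eq_norm_sq, h.norm_gradient y hy, one_pow]
  have h3 := h1.unique ((hasFDerivAt_const (1 : ℝ) x).congr_of_eventuallyEq h2)
  have h4 := congrArg (fun L : E →L[ℝ] ℝ => L a) h3
  simp only [ContinuousLinearMap.comp_apply, ContinuousLinearMap.prod_apply, fderivInnerCLM_apply,
    real_inner_comm (∇ v x), _root_.zero_apply] at h4
  linarith [h4, real_inner_comm (∇ v x) (fderiv ℝ (∇ v) x a)]

theorem add_smul_gradient_mem (h : EikonalOnBall v x₀ r K) {x : E} (hx : x ∈ ball x₀ r) {t : ℝ}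
    (ht : |t| < r) : x + t • ∇ v x ∈ ball x₀ (2 * r) := by
  rw [mem_ball, dist_eq_norm] at *
  have hx' : x ∈ ball x₀ (2 * r) := by
    rw [mem_ball, dist_eq_norm]
    linarith [abs_nonneg t]
  calc ‖x + t • ∇ v x - x₀‖ = ‖(x - x₀) + t • ∇ v x‖ := by congr 1; abel
    _ ≤ ‖x - x₀‖ + ‖t • ∇ v x‖ := norm_add_le _ _
    _ = ‖x - x₀‖ + |t| := by rw [norm_smul, h.norm_gradient x hx', mul_one, Real.norm_eq_abs]
    _ < 2 * r := by linarith

omit [InnerProductSpace ℝ E] [CompleteSpace E] in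
theorem mem_ball_two_mul {x : E} (hx : x ∈ ball x₀ r) : x ∈ ball x₀ (2 * r) :=
  ball_subset_ball (by linarith [pos_of_mem_ball hx]) hx

omit [CompleteSpace E] in
theorem hasDerivAt_line (x w : E) (t : ℝ) : HasDerivAt (fun t : ℝ => x + t • w) w t := by
  simpa using ((hasDerivAt_id t).smul_const w).const_add x

/-- The gradient is constant along gradient lines: its deviation `w` from the initial value satisfies
`‖w'‖ ≤ K ‖w‖`, so Grönwall's inequality applies. This needs no third derivatives of `v`. -/
theorem gradient_add_smul_gradient (h : EikonalOnBall v x₀ r K) {x : E} (hx : x ∈ ball x₀ r)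
    {t : ℝ} (ht : |t| < r) : ∇ v (x + t • ∇ v x) = ∇ v x := by
  -- It suffices to follow the line forwards from `0` in either direction `σ = ±1`.
  have key : ∀ σ : ℝ, |σ| = 1 → ∀ s, 0 ≤ s → s < r → ∇ v (x + (s * σ) • ∇ v x) = ∇ v x := by
    intro σ hσ s hs hsr
    have hmem : ∀ τ ∈ Icc 0 s, x + (τ * σ) • ∇ v x ∈ ball x₀ (2 * r) := fun τ hτ =>
      h.add_smul_gradient_mem hx (by
        rw [abs_mul, hσ, mul_one, abs_of_nonneg hτ.1]
        exact hτ.2.trans_lt hsr)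
    have hderiv : ∀ τ ∈ Icc 0 s, HasDerivAt (fun τ : ℝ => ∇ v (x + (τ * σ) • ∇ v x) - ∇ v x)
        (fderiv ℝ (∇ v) (x + (τ * σ) • ∇ v x) (σ • ∇ v x)) τ := fun τ hτ => by
      have h1 := (hasDerivAt_line x (σ • ∇ v x) τ)
      simp only [smul_smul] at h1
      exact ((h.hasFDerivAt_gradient (hmem τ hτ)).comp_hasDerivAt τ h1).sub_const _
    refine sub_eq_zero.1 (eq_zero_of_abs_deriv_le_mul_abs_self_of_eq_zero_right (K := K)
      (f := fun τ : ℝ => ∇ v (x + (τ * σ) • ∇ v x) - ∇ v x)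
      (fun τ hτ => (hderiv τ hτ).continuousAt.continuousWithinAt)
      (fun τ hτ => (hderiv τ (Ico_subset_Icc_self hτ)).hasDerivWithinAt) (by simp)
      (fun τ hτ => ?_) s ⟨hs, le_rfl⟩)
    have hτ' := hmem τ (Ico_subset_Icc_self hτ)
    -- The Hessian kills the gradient at the same point, so only the difference survives.
    have h2 : fderiv ℝ (∇ v) (x + (τ * σ) • ∇ v x) (σ • ∇ v x) =
        -σ • fderiv ℝ (∇ v) (x + (τ * σ) • ∇ v x) (∇ v (x + (τ * σ) • ∇ v x) - ∇ v x) := by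
      rw [map_sub, h.fderiv_gradient_gradient hτ', zero_sub, smul_neg, neg_smul, neg_neg, map_smul]
    rw [h2, norm_smul, norm_neg, Real.norm_eq_abs, hσ, one_mul]
    exact (ContinuousLinearMap.le_opNorm _ _).trans
      (by gcongr; exact h.norm_fderiv_gradient_le _ hτ')
  rcases le_total 0 t with h0 | h0
  · simpa using key 1 (by simp) t h0 ((le_abs_self t).trans_lt ht)
  · simpa using key (-1) (by simp) (-t) (by linarith) ((neg_le_abs t).trans_lt ht)

theorem apply_add_smul_gradient (h : EikonalOnBall v x₀ r K) {x : E} (hx : x ∈ ball x₀ r)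
    {t : ℝ} (ht : |t| < r) : v (x + t • ∇ v x) = v x + t := by
  have hb : ∀ {s : ℝ}, s ∈ ball (0 : ℝ) r → |s| < r := fun {s} hs => by simpa using hs
  have hderiv : ∀ s ∈ ball (0 : ℝ) r, HasDerivAt (fun s : ℝ => v (x + s • ∇ v x)) 1 s := by
    intro s hs
    have h1 := (((h.contDiffAt _ (h.add_smul_gradient_mem hx (hb hs))).differentiableAt
      two_ne_zero).hasFDerivAt).comp_hasDerivAt s (hasDerivAt_line x (∇ v x) s)
    rw [← inner_gradient_eq_fderiv, h.gradient_add_smul_gradient hx (hb hs),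
      real_inner_self_eq_norm_sq, h.norm_gradient x (mem_ball_two_mul hx), one_pow] at h1
    exact h1
  have hderiv' : ∀ s : ℝ, HasDerivAt (fun s => v x + s) 1 s := fun s =>
    (hasDerivAt_id s).const_add _
  have := isOpen_ball.eqOn_of_deriv_eq (convex_ball (0 : ℝ) r).isPreconnected
    (fun s hs => (hderiv s hs).differentiableAt.differentiableWithinAt)
    (fun s _ => (hderiv' s).differentiableAt.differentiableWithinAt)
    (fun s hs => by rw [(hderiv s hs).deriv, (hderiv' s).deriv])
    (mem_ball_self (pos_of_mem_ball hx)) (by simp)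
    (show t ∈ ball (0 : ℝ) r by simpa using ht)
  simpa using this

/-- The Riccati relation `H(x + t ∇v) (1 + t H(x)) = H(x)` for the Hessian `H`, obtained by
differentiating in `x` that the gradient is constant along gradient lines. -/
theorem fderiv_gradient_comp (h : EikonalOnBall v x₀ r K) {x : E} (hx : x ∈ ball x₀ r)
    {t : ℝ} (ht : |t| < r) :
    fderiv ℝ (∇ v) (x + t • ∇ v x) * (1 + t • fderiv ℝ (∇ v) x) = fderiv ℝ (∇ v) x := by
  have hx' := mem_ball_two_mul hx
  have h1 : HasFDerivAt (fun y => y + t • ∇ v y) (ContinuousLinearMap.id ℝ E +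
      t • fderiv ℝ (∇ v) x) x :=
    (hasFDerivAt_id x).add ((h.hasFDerivAt_gradient hx').const_smul t)
  have h2 := (h.hasFDerivAt_gradient (h.add_smul_gradient_mem hx ht)).comp x h1
  have h3 : (∇ v ∘ fun y => y + t • ∇ v y) =ᶠ[𝓝 x] ∇ v := by
    filter_upwards [isOpen_ball.mem_nhds hx] with y hy
    exact h.gradient_add_smul_gradient hy ht
  exact h2.unique ((h.hasFDerivAt_gradient hx').congr_of_eventuallyEq h3)

theorem abs_sub_le (h : EikonalOnBall v x₀ r K) {x : E} (hx : x ∈ ball x₀ (2 * r)) :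
    |v x - v x₀| ≤ ‖x - x₀‖ := by
  have := (convex_ball x₀ (2 * r)).norm_image_sub_le_of_norm_fderiv_le (𝕜 := ℝ) (f := v) (C := 1)
    (fun y hy => (h.contDiffAt y hy).differentiableAt two_ne_zero)
    (fun y hy => by
      rw [← h.norm_gradient y hy]
      exact ((InnerProductSpace.toDual ℝ E).symm.norm_map _).ge)
    (mem_ball_self (pos_of_mem_ball hx)) hx
  simpa using this

end EikonalOnBall

/-- The ball is chosen so small that `r * K ≤ 1 / 2`, which keeps `1 + t * λ` positive for `|t| < r`
and every eigenvalue `λ` of the Hessian. -/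
theorem exists_eikonalOnBall {v : E → ℝ} {Ω : Set E} (hΩ : IsOpen Ω) (hv : ContDiffOn ℝ 2 v Ω)
    (hgrad : ∀ x ∈ Ω, ‖∇ v x‖ = 1) {x₀ : E} (hx₀ : x₀ ∈ Ω) :
    ∃ r K, 0 < r ∧ r * K ≤ 1 / 2 ∧ ball x₀ (2 * r) ⊆ Ω ∧ EikonalOnBall v x₀ r K := by
  have hc : ContinuousAt (fun x => ‖fderiv ℝ (∇ v) x‖) x₀ :=
    ((contDiffAt_gradient (hv.contDiffAt (hΩ.mem_nhds hx₀))).fderiv_right (m := 0)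
      (by norm_num)).continuousAt.norm
  set K := ‖fderiv ℝ (∇ v) x₀‖ + 1 with hK
  have hev : ∀ᶠ x in 𝓝 x₀, x ∈ Ω ∧ ‖fderiv ℝ (∇ v) x‖ < K :=
    (hΩ.eventually_mem hx₀).and (hc.eventually_lt continuousAt_const (by simp [hK]))
  obtain ⟨ε, hε, hball⟩ := Metric.eventually_nhds_iff_ball.1 hev
  have hK0 : 0 < K := by positivity
  set r := min (ε / 2) (1 / (2 * K)) with hr
  have hr0 : 0 < r := by positivity
  have hsub : ball x₀ (2 * r) ⊆ ball x₀ ε :=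
    ball_subset_ball (by linarith [min_le_left (ε / 2) (1 / (2 * K))])
  refine ⟨r, K, hr0, ?_, fun x hx => (hball x (hsub hx)).1, ?_, ?_, ?_⟩
  · calc r * K ≤ 1 / (2 * K) * K := by gcongr; exact min_le_right _ _
      _ = 1 / 2 := by field_simp
  · exact fun x hx => hv.contDiffAt (hΩ.mem_nhds (hball x (hsub hx)).1)
  · exact fun x hx => hgrad x (hball x (hsub hx)).1
  · exact fun x hx => (hball x (hsub hx)).2.le

end Eikonal

/-! ### The Hessian matrix near a point -/

section HessianMatrix

open Matrix

variable {n : ℕ} {v : EuclideanSpace ℝ (Fin n) → ℝ} {x : EuclideanSpace ℝ (Fin n)}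

theorem hessianMatrix_apply (hv : ContDiffAt ℝ 2 v x) (i j : Fin n) :
    hessianMatrix v x i j =
      ⟪fderiv ℝ (∇ v) x (EuclideanSpace.single i 1), EuclideanSpace.single j (1 : ℝ)⟫ := by
  rw [inner_fderiv_gradient hv, hessianMatrix, Matrix.of_apply, iteratedFDeriv_two_apply]
  rfl

theorem isHermitian_hessianMatrix (hv : ContDiffAt ℝ 2 v x) : (hessianMatrix v x).IsHermitian := by
  ext i j
  simp only [conjTranspose_apply, star_trivial]
  rw [hessianMatrix_apply hv, hessianMatrix_apply hv, inner_fderiv_gradient_comm hv]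

theorem toEuclideanCLM_hessianMatrix (hv : ContDiffAt ℝ 2 v x) :
    Matrix.toEuclideanCLM (𝕜 := ℝ) (hessianMatrix v x) = fderiv ℝ (∇ v) x := by
  apply ContinuousLinearMap.coe_injective
  refine (EuclideanSpace.basisFun (Fin n) ℝ).toBasis.ext fun j => ?_
  ext i
  have h := hessianMatrix_apply hv i j
  rw [inner_fderiv_gradient_comm hv] at h
  simp only [EuclideanSpace.inner_single_right] at h
  simpa using h

theorem trace_hessianMatrix (v : EuclideanSpace ℝ (Fin n) → ℝ) (x : EuclideanSpace ℝ (Fin n)) :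
    (hessianMatrix v x).trace = Laplacian.laplacian v x := by
  rw [InnerProductSpace.laplacian_eq_iteratedFDeriv_orthonormalBasis v
    (EuclideanSpace.basisFun (Fin n) ℝ)]
  simp [Matrix.trace, hessianMatrix]

theorem abs_eigenvalues_le (hv : ContDiffAt ℝ 2 v x) (i : Fin n) :
    |(isHermitian_hessianMatrix hv).eigenvalues i| ≤ ‖fderiv ℝ (∇ v) x‖ := by
  set hA := isHermitian_hessianMatrix hv
  have h1 : fderiv ℝ (∇ v) x (hA.eigenvectorBasis i) =
      hA.eigenvalues i • hA.eigenvectorBasis i := by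
    rw [← toEuclideanCLM_hessianMatrix hv]
    ext j
    have := congrFun (hA.mulVec_eigenvectorBasis i) j
    simpa using this
  have h2 := (fderiv ℝ (∇ v) x).le_opNorm (hA.eigenvectorBasis i)
  rw [h1, norm_smul, hA.eigenvectorBasis.norm_eq_one, mul_one, mul_one] at h2
  exact h2

namespace EikonalOnBall

variable {x₀ : EuclideanSpace ℝ (Fin n)} {r K : ℝ}

theorem hessianMatrix_mul (h : EikonalOnBall v x₀ r K) (hx : x ∈ ball x₀ r) {t : ℝ}
    (ht : |t| < r) :
    hessianMatrix v (x + t • ∇ v x) * (1 + t • hessianMatrix v x) = hessianMatrix v x := by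
  apply (Matrix.toEuclideanCLM (n := Fin n) (𝕜 := ℝ)).injective
  change Matrix.toEuclideanCLM (n := Fin n) (𝕜 := ℝ) _ =
    Matrix.toEuclideanCLM (n := Fin n) (𝕜 := ℝ) _
  rw [map_mul, map_add, map_one, map_smul,
    toEuclideanCLM_hessianMatrix (h.contDiffAt x (mem_ball_two_mul hx)),
    toEuclideanCLM_hessianMatrix (h.contDiffAt _ (h.add_smul_gradient_mem hx ht)),
    h.fderiv_gradient_comp hx ht]

theorem one_add_mul_pos (h : EikonalOnBall v x₀ r K) (hrK : r * K ≤ 1 / 2)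
    (hx : x ∈ ball x₀ (2 * r)) {t : ℝ} (ht : |t| < r) (i : Fin n) :
    0 < 1 + t * (isHermitian_hessianMatrix (h.contDiffAt x hx)).eigenvalues i := by
  have h1 := (abs_eigenvalues_le (h.contDiffAt x hx) i).trans (h.norm_fderiv_gradient_le x hx)
  have h2 := mul_le_mul ht.le h1 (abs_nonneg _) ((abs_nonneg t).trans ht.le)
  rw [← abs_mul] at h2
  linarith [neg_le_of_abs_le (h2.trans hrK)]

/-- The trace of the Riccati relation: as `v` grows at unit speed along gradient lines, the value of
`v x` determines the left side for all small `t`. -/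
theorem sum_eigenvalues_div (h : EikonalOnBall v x₀ r K) (hrK : r * K ≤ 1 / 2) {g : ℝ → ℝ}
    (hlap : ∀ y ∈ ball x₀ (2 * r), Laplacian.laplacian v y = g (v y)) (hx : x ∈ ball x₀ r)
    {hA : (hessianMatrix v x).IsHermitian} {t : ℝ} (ht : |t| < r) :
    ∑ i, hA.eigenvalues i / (1 + t * hA.eigenvalues i) = g (v x + t) := by
  rw [← hA.trace_eq_sum_of_mul_eq
    (fun i => (h.one_add_mul_pos hrK (mem_ball_two_mul hx) ht i).ne') (h.hessianMatrix_mul hx ht),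
    trace_hessianMatrix, hlap _ (h.add_smul_gradient_mem hx ht), h.apply_add_smul_gradient hx ht]

theorem charpoly_eq (h : EikonalOnBall v x₀ r K) (hrK : r * K ≤ 1 / 2) {g : ℝ → ℝ}
    (hlap : ∀ y ∈ ball x₀ (2 * r), Laplacian.laplacian v y = g (v y))
    {y : EuclideanSpace ℝ (Fin n)} (hx : x ∈ ball x₀ r) (hy : y ∈ ball x₀ r) (hxy : v x = v y) :
    (hessianMatrix v x).charpoly = (hessianMatrix v y).charpoly := by
  have hx' := mem_ball_two_mul hx
  have hy' := mem_ball_two_mul hy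
  refine (isHermitian_hessianMatrix (h.contDiffAt x hx')).charpoly_eq_of_sum_eq
    (isHermitian_hessianMatrix (h.contDiffAt y hy')) (pos_of_mem_ball hx)
    (fun t ht => h.one_add_mul_pos hrK hx' ht) (fun t ht => h.one_add_mul_pos hrK hy' ht)
    fun t ht => ?_
  rw [h.sum_eigenvalues_div hrK hlap hx ht, h.sum_eigenvalues_div hrK hlap hy ht, hxy]

/-- The gradient is an eigenvector for the eigenvalue `0`. -/
theorem exists_eigenvalues_eq_zero (h : EikonalOnBall v x₀ r K) (hx : x ∈ ball x₀ (2 * r))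
    (hA : (hessianMatrix v x).IsHermitian) : ∃ i, hA.eigenvalues i = 0 := by
  have hdet : (hessianMatrix v x).det = 0 := by
    refine Matrix.exists_mulVec_eq_zero_iff.1 ⟨(∇ v x).ofLp, fun h0 => ?_, ?_⟩
    · have h1 : ∇ v x = 0 := by
        ext i
        exact congrFun h0 i
      simpa [h1] using h.norm_gradient x hx
    · have h1 := h.fderiv_gradient_gradient hx
      rw [← toEuclideanCLM_hessianMatrix (h.contDiffAt x hx)] at h1
      ext i
      have h2 := congrArg (fun w : EuclideanSpace ℝ (Fin n) => w i) h1
      simpa using h2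
  rw [hA.det_eq_prod_eigenvalues, Finset.prod_eq_zero_iff] at hdet
  obtain ⟨i, _, hi⟩ := hdet
  exact ⟨i, by simpa using hi⟩

/-- The constants `c i` are the distinct eigenvalues of the Hessian at `x₀`, hence at every point of
`{v = 0}` near `x₀`; the eigenprojections at `x` are those at the foot of `x` on that level set. -/
theorem exists_eigenprojections (h : EikonalOnBall v x₀ r K) (hrK : r * K ≤ 1 / 2) {g : ℝ → ℝ}
    (hr : 0 < r)
    (hlap : ∀ y ∈ ball x₀ (2 * r), Laplacian.laplacian v y = g (v y)) (hv0 : v x₀ = 0) :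
    ∃ (m : ℕ) (c : Fin (m + 1) → ℝ) (P : Fin (m + 1) → EuclideanSpace ℝ (Fin n) →
        Matrix (Fin n) (Fin n) ℝ), c 0 = 0 ∧ Function.Injective c ∧
      ∀ x ∈ ball x₀ (r / 2), (∀ i, 0 < 1 + c i * v x) ∧
        hessianMatrix v x = ∑ i, (c i / (1 + c i * v x)) • P i x ∧
        IsCompleteSetOfEigenprojections (hessianMatrix v x)
          (fun i => c i / (1 + c i * v x)) (fun i => P i x) := by
  have hx₀ : x₀ ∈ ball x₀ r := mem_ball_self hr
  have hx₀' := mem_ball_two_mul hx₀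
  set hA₀ := isHermitian_hessianMatrix (h.contDiffAt x₀ hx₀') with hA₀_def
  obtain ⟨i₀, hi₀⟩ := h.exists_eigenvalues_eq_zero hx₀' hA₀
  obtain ⟨m, c, hc0, hcinj, hcrange⟩ := exists_enumeration_zero
    (S := Finset.univ.image hA₀.eigenvalues) (Finset.mem_image.2 ⟨i₀, Finset.mem_univ _, hi₀⟩)
  rw [Finset.coe_image, Finset.coe_univ, image_univ] at hcrange
  have key : ∀ x ∈ ball x₀ (r / 2), ∃ P : Fin (m + 1) → Matrix (Fin n) (Fin n) ℝ,
      (∀ i, 0 < 1 + c i * v x) ∧ hessianMatrix v x = ∑ i, (c i / (1 + c i * v x)) • P i ∧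
        IsCompleteSetOfEigenprojections (hessianMatrix v x) (fun i => c i / (1 + c i * v x)) P := by
    intro x hx
    have hxr : x ∈ ball x₀ r := ball_subset_ball (by linarith) hx
    have hvx : |v x| < r / 2 := by
      have := h.abs_sub_le (mem_ball_two_mul hxr)
      rw [hv0, sub_zero] at this
      rw [mem_ball, dist_eq_norm] at hx
      linarith
    have hvr : |v x| < r := by linarith
    -- `y` is the foot of `x` on the level set `{v = 0}`.
    set y := x + (-v x) • ∇ v x with hy
    have hneg : |-v x| < r := by rwa [abs_neg]
    have hyr : y ∈ ball x₀ r := by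
      rw [mem_ball, dist_eq_norm] at hx ⊢
      calc ‖y - x₀‖ = ‖(x - x₀) + (-v x) • ∇ v x‖ := by rw [hy]; congr 1; abel
        _ ≤ ‖x - x₀‖ + ‖(-v x) • ∇ v x‖ := norm_add_le _ _
        _ = ‖x - x₀‖ + |v x| := by
          rw [norm_smul, h.norm_gradient x (mem_ball_two_mul hxr), mul_one, norm_neg,
            Real.norm_eq_abs]
        _ < r := by linarith
    have hyv : v y = 0 := by
      rw [hy, h.apply_add_smul_gradient hxr hneg, add_neg_cancel]
    have hyN : ∇ v y = ∇ v x := h.gradient_add_smul_gradient hxr hneg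
    have hyx : y + v x • ∇ v y = x := by
      rw [hyN, hy]
      module
    have hmul := h.hessianMatrix_mul hyr hvr
    rw [hyx] at hmul
    have hA := isHermitian_hessianMatrix (h.contDiffAt y (mem_ball_two_mul hyr))
    have hrange : range c = range hA.eigenvalues := by
      rw [hcrange, hA₀.range_eigenvalues, hA.range_eigenvalues,
        h.charpoly_eq hrK hlap hx₀ hyr (hv0.trans hyv.symm)]
    have hpos : ∀ i, 0 < 1 + c i * v x := fun i => by
      obtain ⟨j, hj⟩ : c i ∈ range hA₀.eigenvalues := hcrange ▸ mem_range_self i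
      rw [← hj, mul_comm]
      exact h.one_add_mul_pos hrK hx₀' hvr j
    obtain ⟨P, hP⟩ := hA.exists_isCompleteSetOfEigenprojections hcinj hrange hpos hmul
    exact ⟨P, hpos, hP⟩
  choose! P hP using key
  exact ⟨m, c, fun i x => P x i, hc0, hcinj, hP⟩

end EikonalOnBall

end HessianMatrix

/-! ### Analyticity of the solution -/

section Analytic

open Matrix

/-- The primitive is the real part of a holomorphic primitive on a complex disc. -/
theorem exists_analytic_primitive {n : ℕ} (l : Fin n → ℝ) {r : ℝ}
    (hr : ∀ i, r * |l i| ≤ 1 / 2) :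
    ∃ φ : ℝ → ℝ, ∀ s ∈ ball (0 : ℝ) r, AnalyticAt ℝ φ s ∧
      HasDerivAt φ (∏ i, (1 + s * l i))⁻¹ s := by
  have hne : ∀ z ∈ ball (0 : ℂ) r, ∏ i, (1 + z * l i) ≠ 0 := fun z hz => by
    rw [Finset.prod_ne_zero_iff]
    intro i _ h0
    rw [mem_ball, dist_zero_right] at hz
    have h1 : ‖z * l i‖ ≤ 1 / 2 := by
      rw [norm_mul, Complex.norm_real, Real.norm_eq_abs]
      exact (mul_le_mul_of_nonneg_right hz.le (abs_nonneg _)).trans (hr i)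
    rw [eq_neg_of_add_eq_zero_right h0, norm_neg, norm_one] at h1
    norm_num at h1
  have hdiff : DifferentiableOn ℂ (fun z : ℂ => (∏ i, (1 + z * l i))⁻¹) (ball 0 r) := by
    refine DifferentiableOn.inv ?_ hne
    fun_prop
  obtain ⟨Φ, hΦ⟩ := hdiff.isExactOn_ball
  have hΦa : ∀ z ∈ ball (0 : ℂ) r, AnalyticAt ℂ Φ z := fun z hz =>
    DifferentiableOn.analyticAt
      (fun w hw => (hΦ w hw).differentiableAt.differentiableWithinAt) (isOpen_ball.mem_nhds hz)
  refine ⟨fun s => (Φ s).re, fun s hs => ?_⟩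
  have hs' : (s : ℂ) ∈ ball (0 : ℂ) r := by
    rw [mem_ball, dist_zero_right] at hs ⊢
    rwa [Complex.norm_real]
  constructor
  · have h1 : AnalyticAt ℝ Φ (s : ℂ) := (hΦa s hs').restrictScalars
    exact (Complex.reCLM.analyticAt _).comp (h1.comp (Complex.ofRealCLM.analyticAt s))
  · have h2 := (hΦ s hs').real_of_complex
    convert h2 using 1
    rw [← Complex.ofReal_re (∏ i, (1 + s * l i))⁻¹]
    congr 1
    push_cast
    rfl

theorem hasDerivAt_inv_prod_one_add_mul {n : ℕ} (l : Fin n → ℝ) {t : ℝ}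
    (h : ∀ i, 1 + t * l i ≠ 0) :
    HasDerivAt (fun t => (∏ i, (1 + t * l i))⁻¹)
      (-(∑ i, l i / (1 + t * l i)) * (∏ i, (1 + t * l i))⁻¹) t := by
  have hne : ∏ i, (1 + t * l i) ≠ 0 := Finset.prod_ne_zero_iff.2 fun i _ => h i
  have hd : DifferentiableAt ℝ (fun t => ∏ i, (1 + t * l i)) t := by fun_prop
  have hfac : ∀ i, HasDerivAt (fun t => 1 + t * l i) (l i) t := fun i => by
    simpa using ((hasDerivAt_id t).mul_const (l i)).const_add 1
  have h1 : logDeriv (fun t => ∏ i, (1 + t * l i)) t = ∑ i, l i / (1 + t * l i) := by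
    rw [logDeriv_prod (fun i _ => h i) fun i _ => (hfac i).differentiableAt]
    exact Finset.sum_congr rfl fun i _ => by rw [logDeriv_apply, (hfac i).deriv]
  rw [logDeriv_apply, div_eq_iff hne] at h1
  refine (hd.hasDerivAt.inv hne).congr_deriv ?_
  rw [h1]
  generalize ∑ i, l i / (1 + t * l i) = S
  field_simp

theorem laplacian_comp {E : Type*} [NormedAddCommGroup E] [InnerProductSpace ℝ E]
    [FiniteDimensional ℝ E] {v : E → ℝ} {x : E} (hv : ContDiffAt ℝ 2 v x) {φ φ' : ℝ → ℝ}
    {φ'' : ℝ} (hφ : ∀ᶠ s in 𝓝 (v x), HasDerivAt φ (φ' s) s) (hφ' : HasDerivAt φ' φ'' (v x)) :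
    Laplacian.laplacian (φ ∘ v) x =
      φ' (v x) * Laplacian.laplacian v x + φ'' * ‖∇ v x‖ ^ 2 := by
  have hfd : fderiv ℝ (φ ∘ v) =ᶠ[𝓝 x] fun y => φ' (v y) • fderiv ℝ v y := by
    filter_upwards [hv.continuousAt.eventually hφ, hv.eventually (by simp)] with y hy hvy
    exact (hy.comp_hasFDerivAt y (hvy.differentiableAt two_ne_zero).hasFDerivAt).fderiv
  have h2 : HasFDerivAt (fun y => φ' (v y) • fderiv ℝ v y) _ x :=
    (hφ'.comp_hasFDerivAt x (hv.differentiableAt two_ne_zero).hasFDerivAt).smul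
      ((hv.fderiv_right (m := 1) (by norm_num)).differentiableAt one_ne_zero).hasFDerivAt
  let b := stdOrthonormalBasis ℝ E
  rw [InnerProductSpace.laplacian_eq_iteratedFDeriv_orthonormalBasis (φ ∘ v) b,
    InnerProductSpace.laplacian_eq_iteratedFDeriv_orthonormalBasis v b]
  have h3 : ∀ i, iteratedFDeriv ℝ 2 (φ ∘ v) x ![b i, b i] =
      φ' (v x) * iteratedFDeriv ℝ 2 v x ![b i, b i] + φ'' * ⟪∇ v x, b i⟫ ^ 2 := fun i => by
    rw [iteratedFDeriv_two_apply, iteratedFDeriv_two_apply, hfd.fderiv_eq, h2.fderiv,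
      inner_gradient_eq_fderiv]
    simp
    ring
  simp only [h3, Finset.sum_add_distrib, ← Finset.mul_sum]
  have h4 := b.sum_sq_norm_inner_left (∇ v x)
  simp only [Real.norm_eq_abs, sq_abs] at h4
  rw [h4]

/-- By the analytic inverse function theorem in one variable. -/
theorem analyticAt_of_comp_analyticAt {E : Type*} [NormedAddCommGroup E] [NormedSpace ℝ E]
    {v : E → ℝ} {x : E} {φ : ℝ → ℝ} {φ' : ℝ} (hv : ContinuousAt v x)
    (hφ : AnalyticAt ℝ φ (v x)) (hφ' : HasDerivAt φ φ' (v x)) (h0 : φ' ≠ 0)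
    (h : AnalyticAt ℝ (φ ∘ v) x) : AnalyticAt ℝ v x := by
  have hc : ContDiffAt ℝ ω φ (v x) := hφ.contDiffAt
  have hf : HasFDerivAt φ ((ContinuousLinearEquiv.unitsEquivAut ℝ (Units.mk0 φ' h0) : ℝ ≃L[ℝ] ℝ) :
      ℝ →L[ℝ] ℝ) (v x) := by
    refine hφ'.hasFDerivAt.congr_fderiv ?_
    ext
    simp
  have hψ : AnalyticAt ℝ (hc.localInverse hf (by simp)) (φ (v x)) :=
    (hc.to_localInverse hf (by simp)).analyticAt
  have hleft := (hc.hasStrictFDerivAt' hf (by simp)).eventually_left_inverse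
  refine (hψ.comp_of_eq h rfl).congr ?_
  filter_upwards [hv.eventually hleft] with y hy
  exact hy

/-- With `φ' = 1 / ∏ i, (1 + s * λ i)`, where `λ i` are the eigenvalues of the Hessian at `x₀`, one
has `φ''(s) + g (v x₀ + s) φ'(s) = 0`, so `φ ∘ (v - v x₀)` is harmonic. -/
theorem EikonalOnBall.analyticAt {n : ℕ} {v : EuclideanSpace ℝ (Fin n) → ℝ}
    {x₀ : EuclideanSpace ℝ (Fin n)} {r K : ℝ} (h : EikonalOnBall v x₀ r K)
    (hrK : r * K ≤ 1 / 2) (hr : 0 < r) {g : ℝ → ℝ}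
    (hlap : ∀ y ∈ ball x₀ (2 * r), Laplacian.laplacian v y = g (v y)) : AnalyticAt ℝ v x₀ := by
  have hx₀ : x₀ ∈ ball x₀ r := mem_ball_self hr
  have hx₀' := EikonalOnBall.mem_ball_two_mul hx₀
  set hA := isHermitian_hessianMatrix (h.contDiffAt x₀ hx₀')
  set l := hA.eigenvalues with hl
  have hpos : ∀ s, |s| < r → ∀ i, 0 < 1 + s * l i := fun s hs => h.one_add_mul_pos hrK hx₀' hs
  have hlr : ∀ i, r * |l i| ≤ 1 / 2 := fun i => (mul_le_mul_of_nonneg_left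
    ((abs_eigenvalues_le (h.contDiffAt x₀ hx₀') i).trans (h.norm_fderiv_gradient_le x₀ hx₀')) hr.le).trans hrK
  obtain ⟨φ, hφ⟩ := exists_analytic_primitive l hlr
  set w : EuclideanSpace ℝ (Fin n) → ℝ := fun x => φ (v x - v x₀) with hw
  have hmem : ∀ x ∈ ball x₀ r, v x - v x₀ ∈ ball (0 : ℝ) r := fun x hx => by
    rw [mem_ball, dist_zero_right, Real.norm_eq_abs]
    exact (h.abs_sub_le (EikonalOnBall.mem_ball_two_mul hx)).trans_lt
      (by rwa [mem_ball, dist_eq_norm] at hx)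
  have hharm : InnerProductSpace.HarmonicAt w x₀ := by
    have hshift : ∀ s, HasDerivAt (fun s => s - v x₀) 1 s := fun s => (hasDerivAt_id s).sub_const _
    refine ⟨?_, ?_⟩
    · refine (hφ _ (hmem x₀ hx₀)).1.contDiffAt.comp x₀ ?_
      exact (h.contDiffAt x₀ hx₀').sub contDiffAt_const
    · filter_upwards [isOpen_ball.mem_nhds hx₀] with x hx
      have hx' := EikonalOnBall.mem_ball_two_mul hx
      have ht : |v x - v x₀| < r := by simpa using hmem x hx
      have h1 : ∀ᶠ s in 𝓝 (v x), HasDerivAt (fun s => φ (s - v x₀))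
          (∏ i, (1 + (s - v x₀) * l i))⁻¹ s := by
        have hc : ContinuousAt (fun s => s - v x₀) (v x) := (hshift _).continuousAt
        filter_upwards [hc.eventually (isOpen_ball.mem_nhds (hmem x hx))] with s hs
        have := (hφ _ hs).2.comp s (hshift s)
        rwa [mul_one] at this
      have h2 := (hasDerivAt_inv_prod_one_add_mul l fun i => (hpos _ ht i).ne').comp (v x)
        (hshift (v x))
      rw [mul_one] at h2
      have h3 := laplacian_comp (h.contDiffAt x hx') h1 h2
      have h4 := h.sum_eigenvalues_div hrK hlap hx₀ (hA := hA) ht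
      rw [add_sub_cancel] at h4
      change Laplacian.laplacian ((fun s => φ (s - v x₀)) ∘ v) x = 0
      rw [h3, hlap x hx', h.norm_gradient x hx', hl, h4]
      ring
  have h0 : v x₀ - v x₀ = 0 := sub_self _
  have hv : AnalyticAt ℝ (fun x => v x - v x₀) x₀ := by
    have h1 := hφ _ (hmem x₀ hx₀)
    refine analyticAt_of_comp_analyticAt (φ := φ) (φ' := 1)
      ((h.contDiffAt x₀ hx₀').continuousAt.sub continuousAt_const) h1.1 ?_ one_ne_zero
      (analyticAt_of_harmonicAt hharm)
    simpa using h1.2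
  refine (hv.add (analyticAt_const (v := v x₀))).congr (Eventually.of_forall fun x => ?_)
  simp

end Analytic

theorem proposition3p1 (n : ℕ) (Ω : Set (EuclideanSpace ℝ (Fin n)))
    (hΩ_open : IsOpen Ω) (hΩ_conn : IsPreconnected Ω)
    (v : EuclideanSpace ℝ (Fin n) → ℝ) (hv : ContDiffOn ℝ 2 v Ω)
    (hgrad : ∀ x ∈ Ω, ‖∇ v x‖ = 1)
    (g : ℝ → ℝ) (hlap : ∀ x ∈ Ω, Laplacian.laplacian v x = g (v x)) :
    AnalyticOnNhd ℝ v Ω ∧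
    ∀ x₀ ∈ Ω, v x₀ = 0 →
      ∃ U : Set (EuclideanSpace ℝ (Fin n)), IsOpen U ∧ x₀ ∈ U ∧ U ⊆ Ω ∧
      ∃ (m : ℕ) (c : Fin (m + 1) → ℝ)
        (P : Fin (m + 1) → EuclideanSpace ℝ (Fin n) → Matrix (Fin n) (Fin n) ℝ),
        c 0 = 0 ∧ Function.Injective c ∧
        (∀ x ∈ U, (∀ i, 0 < 1 + c i * v x) ∧
          hessianMatrix v x = ∑ i, (c i / (1 + c i * v x)) • P i x ∧
          IsCompleteSetOfEigenprojections (hessianMatrix v x)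
            (fun i => c i / (1 + c i * v x)) (fun i => P i x)) ∧
        -- the eigenvalues, with their multiplicities, depend only on the value of `v`
        (∀ x ∈ U, ∀ y ∈ U, v x = v y →
          (hessianMatrix v x).charpoly = (hessianMatrix v y).charpoly) := by
  refine ⟨fun x₀ hx₀ => ?_, fun x₀ hx₀ hv0 => ?_⟩
  · obtain ⟨r, K, hr, hrK, hsub, h⟩ := exists_eikonalOnBall hΩ_open hv hgrad hx₀
    exact h.analyticAt hrK hr fun y hy => hlap y (hsub hy)
  · obtain ⟨r, K, hr, hrK, hsub, h⟩ := exists_eikonalOnBall hΩ_open hv hgrad hx₀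
    have hlap' : ∀ y ∈ ball x₀ (2 * r), Laplacian.laplacian v y = g (v y) :=
      fun y hy => hlap y (hsub hy)
    obtain ⟨m, c, P, hc0, hcinj, hP⟩ := h.exists_eigenprojections hrK hr hlap' hv0
    have hU : ball x₀ (r / 2) ⊆ ball x₀ r := ball_subset_ball (by linarith)
    exact ⟨ball x₀ (r / 2), isOpen_ball, mem_ball_self (half_pos hr),
      fun x hx => hsub (EikonalOnBall.mem_ball_two_mul (hU hx)), m, c, P, hc0, hcinj, hP,
      fun x hx y hy hxy => h.charpoly_eq hrK hlap' (hU hx) (hU hy) hxy⟩
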